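/- **Setting.** Let $E$ be a finite-dimensional real normed vector space, $B_c$ the closed ball of radius $c$ about $\mathbf 0$, and $X$ a set (of labels). A *pattern* is a function $P\colon E\to X$, written $x\mapsto P[x]$; for $x\in E$ and $U\subseteq E$ let $P[x,U]\colon U\to X$, $u\mapsto P[x+u]$. Put $(P+z)[x]=P[x-z]$, and for a linear automorphism $L$ of $E$ put $(LP)[x]=P[L^{-1}x]$. The *group of periods* of $P$ is $\mathcal K_P=\{z\in E: P=P+z\}$, and $P$ is *nonperiodic* if $\mathcal K_P=\{\mathbf 0\}$. A (closed) subgroup $G\le E$ has *trivial discrete component* if $G/V$ is trivial, where $V$ is the connected component of $\mathbf 0$ in $G$. A *pattern space* is a non-empty set $\Omega$ of patterns $E\to X$ such that a pattern $Q\colon E\to X$ lies in $\Omega$ whenever for all $x\in E$ and compact $U\subseteq E$ there are $R\in\Omega$ and $y\in E$ with $Q[x,U]=R[y,U]$. It carries the *local topology*, induced by the uniformity with base the sets $\Phi(B,U)=\{(P,Q)\in\Omega^2: P[x,U]=Q[y,U]\text{ for some }x,y\in B\}$, for $B$ a neighbourhood of $\mathbf 0$ and $U\subseteq E$ compact. The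 space $\Omega$ is * *FLC* if for each compact $U\subseteq E$ there are finitely many patterns $P_1,\dots,P_n$ and compact sets $K_1,\dots,K_n\subseteq E$ such that for all $Q\in\Omega$ and $x\in E$ there are $i$ and $y\in K_i$ with $Q[x,U]=P_i[y,U]$; * *well-separated* if there is a compact $V\subseteq E$ such that for all $P,Q\in\Omega$ with $P[\mathbf 0]\ne Q[\mathbf 0]$ there is a neighbourhood $B$ of $\mathbf 0$ with $P[b,V]\neq Q[b',V]$ for all $b,b'\in B$; * *return discrete* if there are a neighbourhood $B$ of $\mathbf 0$ and a compact $V\subseteq E$ such that for all $P\in\Omega$ and $b\in B$, $P[\mathbf 0,V]=P[b,V]$ implies $b=\mathbf 0$; * *aperiodic* if every $P\in\Omega$ is nonperiodic. A map $f\colon\Omega\to\Omega'$ between pattern spaces over $E$ is an *LD map* if there is $c\ge 0$ such that for all $P,Q\in\Omega$ and $x,y\in E$, $P[x,B_c]=Q[y,B_c]$ implies $(fP)[x]=(fQ)[y]$. Put $L\Omega=\{LP:P\in\Omega\}$. The pattern space $\Omega$ is *$L$-sub* if it is equipped with a surjective LD map $S\colon L\Omega\to\Omega$ (subdivision); its *substitution*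 is $\sigma\colon\Omega\to\Omega$, $\sigma(P)=S(LP)$. It is *expansive* $L$-sub if moreover all (complex) eigenvalues of $L$ have modulus $>1$. **Theorem 4.7.** Let $\Omega$ be an expansive $L$-sub pattern space. Then $\Omega$ is FLC and well-separated if and only if it is compact and Hausdorff in the local topology. Suppose now that $\Omega$ is FLC and well-separated. Then the following are equivalent: 1. $\sigma\colon\Omega\to\Omega$ is injective; 2. $\mathcal K_P$ has trivial discrete component for all $P\in\Omega$. When (1) holds, $\sigma$ is a homeomorphism, $S$ is bijective, and $S^{-1}\colon\Omega\to L\Omega$ is an LD map. Moreover, $\mathcal K_P$ is discrete for every $P\in\Omega$ if and only if $\Omega$ is return discrete, and in that case (1) and (2) are equivalent to 3. $\Omega$ is aperiodic. -/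

import Mathlib

open Set Topology Pointwise

namespace PatternSpaces

universe u v w

/-- A pattern on `E` with values in the set `S`: an arbitrary function `E → S`. -/
def Pattern (E : Type u) (S : Type v) : Type (max u v) := E → S

section Patterns

variable {E : Type u} [NormedAddCommGroup E] {S : Type v}

/-- `P[x, U]`, the map `U → S`, `u ↦ P[x + u]`. -/
def patch (P : Pattern E S) (x : E) (U : Set E) : U → S := fun t => P (x + t)

/-- The translated pattern `P + z`, with `(P + z)[x] = P[x - z]`. -/
def translate (P : Pattern E S) (z : E) : Pattern E S := fun x => P (x - z)

theorem patch_eq_iff {P Q : Pattern E S} {x y : E} {U : Set E} :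
    patch P x U = patch Q y U ↔ ∀ t ∈ U, P (x + t) = Q (y + t) := by
  constructor
  · intro h t ht
    exact congrFun h ⟨t, ht⟩
  · intro h
    funext t
    exact h t t.2

/-- The group of translational periods `{z | P = P + z}`. -/
def periods (P : Pattern E S) : AddSubgroup E where
  carrier := {z | P = translate P z}
  zero_mem' := by
    funext x
    simp [translate]
  add_mem' := by
    intro a b ha hb
    funext x
    have h1 : P x = P (x - a) := congrFun ha x
    have h2 : P (x - a) = P (x - a - b) := congrFun hb (x - a)
    change P x = P (x - (a + b))
    rw [h1, h2, sub_sub]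
  neg_mem' := by
    intro a ha
    funext x
    have h1 : P (x + a) = P (x + a - a) := congrFun ha (x + a)
    change P x = P (x - -a)
    rw [sub_neg_eq_add, h1, add_sub_cancel_right]

/-- `P` is non-periodic if its only period is `0`. -/
def Nonperiodic (P : Pattern E S) : Prop := periods P = ⊥

/-- The discrete component `G / V` of a closed subgroup `G` of `E`, where `V` is the connected
component of `0` in `G`. -/
abbrev DiscreteComponent (G : AddSubgroup E) : Type u :=
  G ⧸ AddSubgroup.connectedComponentOfZero G

/-- `G` has trivial discrete component if `G / V` is the trivial group. -/
def HasTrivialDiscreteComponent (G : AddSubgroup E) : Prop :=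
  Subsingleton (DiscreteComponent G)

/-- The basic entourage `Φ(B, U)`: the pairs of patterns that agree on `U` up to translations
in `B`. -/
def entourage (S : Type v) (B U : Set E) : Set (Pattern E S × Pattern E S) :=
  {p | ∃ x ∈ B, ∃ y ∈ B, patch p.1 x U = patch p.2 y U}

theorem entourage_mono {B B' U U' : Set E} (hB : B ⊆ B') (hU : U' ⊆ U) :
    entourage S B U ⊆ entourage S B' U' := by
  rintro p ⟨x, hx, y, hy, h⟩
  refine ⟨x, hB hx, y, hB hy, ?_⟩
  rw [patch_eq_iff] at h ⊢
  exact fun t ht => h t (hU ht)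

variable (E S) in
/-- The base of the local uniformity: the sets `Φ(B, U)` with `B` a neighbourhood of `0` and `U`
compact. -/
def localBasis : FilterBasis (Pattern E S × Pattern E S) where
  sets := {e | ∃ B ∈ 𝓝 (0 : E), ∃ U : Set E, IsCompact U ∧ e = entourage S B U}
  nonempty := ⟨_, univ, Filter.univ_mem, ∅, isCompact_empty, rfl⟩
  inter_sets := by
    rintro _ _ ⟨B, hB, U, hU, rfl⟩ ⟨B', hB', U', hU', rfl⟩
    exact ⟨_, ⟨B ∩ B', Filter.inter_mem hB hB', U ∪ U', hU.union hU', rfl⟩,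
      subset_inter (entourage_mono inter_subset_left subset_union_left)
        (entourage_mono inter_subset_right subset_union_right)⟩

end Patterns

section Spaces

variable {E : Type u} [NormedAddCommGroup E] {S : Type v}

/-- The local uniformity on patterns. A set of patterns carries the induced uniformity, whose base
consists of the restrictions of the sets `Φ(B, U)`, and the induced local topology. -/
instance localUniformSpace [NormedSpace ℝ E] [FiniteDimensional ℝ E] :
    UniformSpace (Pattern E S) :=
  UniformSpace.ofCore <| UniformSpace.Core.mkOfBasis (localBasis E S)
    (by
      rintro _ ⟨B, hB, U, hU, rfl⟩ P
      exact ⟨0, mem_of_mem_nhds hB, 0, mem_of_mem_nhds hB, rfl⟩)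
    (by
      rintro _ ⟨B, hB, U, hU, rfl⟩
      refine ⟨_, ⟨B, hB, U, hU, rfl⟩, ?_⟩
      rintro p ⟨x, hx, y, hy, h⟩
      exact ⟨y, hy, x, hx, h.symm⟩)
    (by
      rintro _ ⟨B, hB, U, hU, rfl⟩
      obtain ⟨r, hr, hrB⟩ := Metric.mem_nhds_iff.1 hB
      have : ProperSpace E := FiniteDimensional.proper ℝ E
      have hsub : ∀ a ∈ Metric.closedBall (0 : E) (r / 3),
          ∀ b ∈ Metric.closedBall (0 : E) (r / 3), a - b ∈ B := by
        intro a ha b hb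
        apply hrB
        rw [mem_closedBall_zero_iff] at ha hb
        rw [mem_ball_zero_iff]
        have := norm_sub_le a b
        linarith
      refine ⟨_, ⟨Metric.closedBall 0 (r / 3), Metric.closedBall_mem_nhds 0 (by positivity),
        U - Metric.closedBall 0 (r / 3), by
          rw [sub_eq_add_neg]
          exact hU.add (isCompact_closedBall 0 (r / 3)).neg, rfl⟩, ?_⟩
      rintro ⟨P, R⟩ ⟨Q, ⟨x₁, hx₁, y₁, hy₁, h₁⟩, ⟨x₂, hx₂, y₂, hy₂, h₂⟩⟩
      rw [patch_eq_iff] at h₁ h₂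
      refine ⟨x₁ - y₁, hsub _ hx₁ _ hy₁, y₂ - x₂, hsub _ hy₂ _ hx₂, patch_eq_iff.2 ?_⟩
      intro t ht
      have e₁ := h₁ (t - y₁) (sub_mem_sub ht hy₁)
      have e₂ := h₂ (t - x₂) (sub_mem_sub ht hx₂)
      have a₁ : x₁ - y₁ + t = x₁ + (t - y₁) := by abel
      have a₂ : y₂ - x₂ + t = y₂ + (t - x₂) := by abel
      have a₃ : y₁ + (t - y₁) = x₂ + (t - x₂) := by abel
      change P (x₁ - y₁ + t) = R (y₂ - x₂ + t)
      rw [a₁, a₂]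
      exact e₁.trans ((congrArg Q a₃).trans e₂))

/-- `Q` is locally indistinguishable from the collection `Ω`: every patch of `Q` is a patch of some
element of `Ω`. -/
def LocallyIndistIn (Q : Pattern E S) (Ω : Set (Pattern E S)) : Prop :=
  ∀ (x : E) (U : Set E), IsCompact U → ∃ R ∈ Ω, ∃ y : E, patch Q x U = patch R y U

/-- A (translational) pattern space. -/
def IsPatternSpace (Ω : Set (Pattern E S)) : Prop :=
  Ω.Nonempty ∧ ∀ Q : Pattern E S, LocallyIndistIn Q Ω → Q ∈ Ω

/-- Finite local complexity of a pattern space. -/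
def IsFLC (Ω : Set (Pattern E S)) : Prop :=
  ∀ U : Set E, IsCompact U →
    ∃ (n : ℕ) (P : Fin n → Pattern E S) (K : Fin n → Set E), (∀ i, IsCompact (K i)) ∧
      ∀ Q ∈ Ω, ∀ x : E, ∃ i, ∃ y ∈ K i, patch Q x U = patch (P i) y U

/-- Well-separated pattern spaces. The neighbourhood `B` may depend on the two patterns. -/
def IsWellSeparated (Ω : Set (Pattern E S)) : Prop :=
  ∃ V : Set E, IsCompact V ∧ ∀ P ∈ Ω, ∀ Q ∈ Ω, P 0 ≠ Q 0 →
    ∃ B ∈ 𝓝 (0 : E), ∀ b ∈ B, ∀ b' ∈ B, patch P b V ≠ patch Q b' V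

/-- Return discrete pattern spaces. -/
def IsReturnDiscrete (Ω : Set (Pattern E S)) : Prop :=
  ∃ B ∈ 𝓝 (0 : E), ∃ V : Set E, IsCompact V ∧
    ∀ P ∈ Ω, ∀ b ∈ B, patch P 0 V = patch P b V → b = 0

/-- `Ω` is aperiodic if every element of `Ω` is non-periodic. -/
def IsAperiodic (Ω : Set (Pattern E S)) : Prop := ∀ P ∈ Ω, Nonperiodic P

/-- Local derivation maps: `(f P)[x]` is determined by the `c`-patch of `P` at `x`, by the same rule
for all `P` and `x`. -/
def IsLDMap {S' : Type w} {Ω : Set (Pattern E S)} {Ω' : Set (Pattern E S')} (f : Ω → Ω') : Prop :=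
  ∃ c : ℝ, 0 ≤ c ∧ ∀ (P Q : Ω) (x y : E),
    patch P.1 x (Metric.closedBall 0 c) = patch Q.1 y (Metric.closedBall 0 c) →
      (f P).1 x = (f Q).1 y

variable [NormedSpace ℝ E]

/-- A linear automorphism is expansive if all its (complex) eigenvalues have modulus greater
than `1`. -/
def IsExpansive (L : E ≃ₗ[ℝ] E) : Prop :=
  ∀ μ : ℂ, Module.End.HasEigenvalue ((L : E →ₗ[ℝ] E).baseChange ℂ) μ → 1 < ‖μ‖

/-- The pattern `L P`, with `(L P)[x] = P[L⁻¹ x]`. -/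
def inflate (L : E ≃ₗ[ℝ] E) (P : Pattern E S) : Pattern E S := fun x => P (L.symm x)

/-- `L Ω = {L P | P ∈ Ω}`. -/
def inflateSpace (L : E ≃ₗ[ℝ] E) (Ω : Set (Pattern E S)) : Set (Pattern E S) := inflate L '' Ω

/-- The structure that makes a pattern space `Ω` an `L`-sub pattern space: a surjective local
derivation map `L Ω → Ω`, called subdivision. -/
structure LSub (L : E ≃ₗ[ℝ] E) (Ω : Set (Pattern E S)) where
  subdivision : inflateSpace L Ω → Ω
  isLDMap : IsLDMap subdivision
  surjective : Function.Surjective subdivision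

/-- Substitution: inflation by `L`, followed by subdivision. -/
def LSub.substitution {L : E ≃ₗ[ℝ] E} {Ω : Set (Pattern E S)} (s : LSub L Ω) : Ω → Ω :=
  fun P => s.subdivision ⟨inflate L P.1, mem_image_of_mem _ P.2⟩

end Spaces

end PatternSpaces

/-! An FLC pattern space is complete, because it contains every pattern that is locally in it, and
totally bounded; conversely, a finite cover by entourages gives FLC. In a Hausdorff space, vectors
that shrink to 0 and are periods of `P` on growing balls have multiples filling out lines of genuine
periods. So short local periods lie in `periodSpace P`, the largest linear space of periods
(`exists_mem_periodSpace`). Letting counterexamples accumulate in a compact space gives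
well-separation, return discreteness when the period spaces vanish, and a uniform length below which
periods lie in the period space. Having trivial discrete component means that every period lies in
`periodSpace P`.

Let `σ` be injective. A period of `P = σⁿ Q` pulls back to a period of `Q` contracted by `L⁻ⁿ`. For
large `n` it is short, hence lies on a line of periods, and this line pushes forward to `P`.

Conversely, put `Fₙ P [x] = (σⁿ P)[Lⁿ x]` (`LSub.rescaled`). By expansion, `Fₙ P [x]` depends on a
patch of `P` of radius `C` independent of `n`. Limits of eventual periods of the sequence `Fₙ P`
form a linear space, `asymptoticSpace`. If `σ A = σ B` with `A ≠ B`, take `n`-fold preimages of `A`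
and `B`, translated so that the `Fₙ` differ at 0, and let them accumulate at `P` and `Q`. Comparing
two late indices gives a short asymptotic period of `Q`; if it is a true period, the difference at 0
disappears.

The crux is therefore `LSub.asymptoticSpace_le_periodSpace`. For a counterexample `P` of maximal
dimension, periods of the patterns `P ∘ Lⁿ` are uniformly dense in the unit ball of `L⁻ⁿ V`, where
`V` is the asymptotic space. Dense local periods propagate along strips parallel to this space.
Since every small patch recurs in a bounded region, and `L` widens a strip until it covers that
region, strip periods become global periods, enough of them to span `V`. -/

namespace PatternSpaces

universe u v

/-! ### The local uniformity in terms of balls and a single translation -/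

section LocalTopology

variable {E : Type u} [NormedAddCommGroup E] {S : Type v}

/-- `P` and `Q` agree on the ball of radius `R` up to a translation of norm less than `e`. -/
def Near (R e : ℝ) (P Q : Pattern E S) : Prop :=
  ∃ a : E, ‖a‖ < e ∧ ∀ x : E, ‖x‖ ≤ R → P x = Q (x + a)

theorem Near.mono {R R' e e' : ℝ} {P Q : Pattern E S} (h : Near R e P Q) (hR : R' ≤ R)
    (he : e ≤ e') : Near R' e' P Q := by
  obtain ⟨a, ha, hx⟩ := h
  exact ⟨a, ha.trans_le he, fun x hxR => hx x (hxR.trans hR)⟩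

theorem Near.symm {R e : ℝ} {P Q : Pattern E S} (h : Near R e P Q) :
    Near (R - e) e Q P := by
  obtain ⟨a, ha, hx⟩ := h
  refine ⟨-a, by rwa [norm_neg], fun x hxR => ?_⟩
  rw [hx (x + -a), neg_add_cancel_right]
  have := norm_add_le x (-a)
  rw [norm_neg] at this
  linarith

/-- The pattern `x ↦ P[x + z]`. -/
def shift (z : E) (P : Pattern E S) : Pattern E S := fun x => P (x + z)

@[simp] theorem shift_apply (z : E) (P : Pattern E S) (x : E) : shift z P x = P (x + z) := rfl

theorem mem_periods_iff {P : Pattern E S} {z : E} : z ∈ periods P ↔ ∀ x, P (x + z) = P x := by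
  rw [← neg_mem_iff]
  change P = translate P (-z) ↔ _
  constructor
  · intro h x
    have := congrFun h x
    simp only [translate, sub_neg_eq_add] at this
    exact this.symm
  · intro h
    funext x
    simp only [translate, sub_neg_eq_add]
    exact (h x).symm

theorem IsPatternSpace.shift_mem {Ω : Set (Pattern E S)} (hΩ : IsPatternSpace Ω) {P : Pattern E S}
    (hP : P ∈ Ω) (z : E) : shift z P ∈ Ω := by
  refine hΩ.2 _ fun x U _ => ⟨P, hP, x + z, ?_⟩
  rw [patch_eq_iff]
  intro t _
  change P (x + t + z) = _
  congr 1
  abel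

theorem IsPatternSpace.mem_of_ball {Ω : Set (Pattern E S)} (hΩ : IsPatternSpace Ω)
    {Q : Pattern E S} (h : ∀ R : ℝ, ∃ P ∈ Ω, ∃ a : E, ∀ x : E, ‖x‖ ≤ R → Q x = P (x + a)) :
    Q ∈ Ω := by
  refine hΩ.2 Q fun x U hU => ?_
  obtain ⟨R, hR⟩ := hU.isBounded.exists_norm_le
  obtain ⟨P, hP, a, ha⟩ := h (‖x‖ + R)
  refine ⟨P, hP, x + a, ?_⟩
  rw [patch_eq_iff]
  intro t ht
  rw [ha]
  · congr 1
    abel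
  · exact (norm_add_le _ _).trans (by gcongr; exact hR t ht)

variable [NormedSpace ℝ E] [FiniteDimensional ℝ E]

/-- The two translations in `Φ(B, U)` can be merged into one by moving the first across, at the cost
of enlarging the radius by its norm. -/
theorem mem_uniformity_iff_near {s : Set (Pattern E S × Pattern E S)} :
    s ∈ uniformity (Pattern E S) ↔
      ∃ R e : ℝ, 0 < e ∧ ∀ P Q : Pattern E S, Near R e P Q → (P, Q) ∈ s := by
  have : ProperSpace E := FiniteDimensional.proper ℝ E
  change s ∈ (localBasis E S).filter ↔ _
  rw [FilterBasis.mem_filter_iff]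
  constructor
  · rintro ⟨_, ⟨B, hB, U, hU, rfl⟩, hs⟩
    obtain ⟨e, he, heB⟩ := Metric.mem_nhds_iff.1 hB
    obtain ⟨R, hR⟩ := hU.isBounded.exists_norm_le
    refine ⟨R, e, he, ?_⟩
    rintro P Q ⟨a, ha, hx⟩
    refine hs ⟨0, mem_of_mem_nhds hB, a, heB (by simpa using ha), ?_⟩
    rw [patch_eq_iff]
    intro t ht
    change P (0 + t) = Q (a + t)
    rw [zero_add, add_comm, hx t (hR t ht)]
  · rintro ⟨R, e, he, h⟩
    refine ⟨_, ⟨Metric.ball 0 (e / 2), Metric.ball_mem_nhds 0 (by positivity),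
      Metric.closedBall 0 (R + e / 2), isCompact_closedBall _ _, rfl⟩, ?_⟩
    rintro ⟨P, Q⟩ ⟨b, hb, b', hb', hp⟩
    rw [patch_eq_iff] at hp
    rw [mem_ball_zero_iff] at hb hb'
    refine h P Q ⟨b' - b, (norm_sub_le _ _).trans_lt (by linarith), fun x hx => ?_⟩
    have := hp (x - b) (by
      rw [mem_closedBall_zero_iff]
      exact (norm_sub_le _ _).trans (by linarith))
    simp only [add_sub_cancel] at this
    rw [this]
    congr 1
    abel

theorem mem_uniformity_subtype_iff_near {Ω : Set (Pattern E S)} {s : Set (Ω × Ω)} :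
    s ∈ uniformity Ω ↔ ∃ R e : ℝ, 0 < e ∧ ∀ P Q : Ω, Near R e P.1 Q.1 → (P, Q) ∈ s := by
  rw [uniformity_subtype, Filter.mem_comap]
  constructor
  · rintro ⟨t, ht, hts⟩
    obtain ⟨R, e, he, h⟩ := mem_uniformity_iff_near.1 ht
    exact ⟨R, e, he, fun P Q hPQ => hts (h _ _ hPQ)⟩
  · rintro ⟨R, e, he, h⟩
    refine ⟨{p | Near R e p.1 p.2}, mem_uniformity_iff_near.2 ⟨R, e, he, fun _ _ h => h⟩, ?_⟩
    rintro ⟨P, Q⟩ hPQ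
    exact h P Q hPQ

theorem near_mem_uniformity {Ω : Set (Pattern E S)} (R : ℝ) {e : ℝ} (he : 0 < e) :
    {p : Ω × Ω | Near R e p.1.1 p.2.1} ∈ uniformity Ω :=
  mem_uniformity_subtype_iff_near.2 ⟨R, e, he, fun _ _ h => h⟩

/-- Every family in a compact pattern space accumulates, along an ultrafilter, at an element of the
space. -/
theorem exists_eventually_near {Ω : Set (Pattern E S)} [CompactSpace Ω] {ι : Type*}
    (l : Ultrafilter ι) (P : ι → Ω) :
    ∃ Q : Ω, ∀ R e : ℝ, 0 < e → ∀ᶠ i in (l : Filter ι), Near R e (P i).1 Q.1 := by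
  obtain ⟨Q, -, hQ⟩ := isCompact_univ.ultrafilter_le_nhds (l.map P) (by simp)
  refine ⟨Q, fun R e he => ?_⟩
  have h := mem_nhds_right Q (near_mem_uniformity (Ω := Ω) R he)
  exact hQ h

theorem eq_of_forall_near {Ω : Set (Pattern E S)} [T2Space Ω] (P Q : Ω)
    (h : ∀ R e : ℝ, 0 < e → Near R e P.1 Q.1) : P = Q := by
  refine eq_of_forall_symmetric ?_
  intro V hV _
  obtain ⟨R, e, he, h'⟩ := mem_uniformity_subtype_iff_near.1 hV
  exact h' _ _ (h R e he)

theorem t2Space_of_forall_near {Ω : Set (Pattern E S)}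
    (h : ∀ P Q : Ω, (∀ R e : ℝ, 0 < e → Near R e P.1 Q.1) → P = Q) : T2Space Ω := by
  have : T0Space Ω := by
    rw [t0Space_iff_uniformity]
    intro P Q hPQ
    exact h P Q fun R e he => hPQ _ (near_mem_uniformity R he)
  infer_instance

/-- This allows completeness to be tested on sequences. -/
instance (Ω : Set (Pattern E S)) : (uniformity Ω).IsCountablyGenerated := by
  refine Filter.HasCountableBasis.isCountablyGenerated (ι := ℕ) (p := fun _ => True)
    (s := fun n => {p : Ω × Ω | Near n (1 / ((n : ℝ) + 1)) p.1.1 p.2.1}) ⟨⟨fun t => ?_⟩, to_countable _⟩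
  constructor
  · intro ht
    obtain ⟨R, e, he, h⟩ := mem_uniformity_subtype_iff_near.1 ht
    obtain ⟨n, hn⟩ := exists_nat_gt (max R (1 / e))
    have hn' : (0 : ℝ) < n := (lt_of_lt_of_le (by positivity) (le_max_right _ _)).trans hn
    refine ⟨n, trivial, fun p hp => h _ _ (hp.mono ((le_max_left _ _).trans hn.le) ?_)⟩
    have : 1 / e < n := (le_max_right _ _).trans_lt hn
    rw [div_lt_iff₀ he] at this
    rw [div_le_iff₀ (by positivity)]
    linarith
  · rintro ⟨n, -, hn⟩
    exact Filter.mem_of_superset (near_mem_uniformity _ (by positivity)) hn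

end LocalTopology

/-! ### Completeness, and FLC as compactness -/

section FiniteLocalComplexity

variable {E : Type u} [NormedAddCommGroup E] [NormedSpace ℝ E] [FiniteDimensional ℝ E] {S : Type v}

theorem IsPatternSpace.completeSpace {Ω : Set (Pattern E S)} (hΩ : IsPatternSpace Ω) :
    CompleteSpace Ω := by
  have : CompleteSpace E := FiniteDimensional.complete ℝ E
  -- The partial sums of the successive translations stay within norm 4, so the surplus 10 in the
  -- radius keeps all comparisons inside the balls of agreement.
  refine UniformSpace.complete_of_convergent_controlled_sequences
    (fun N => {p : Ω × Ω | Near ((N : ℝ) + 10) (1 / 2 ^ N) p.1.1 p.2.1})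
    (fun N => near_mem_uniformity _ (by positivity)) fun p hp => ?_
  choose a ha hpa using fun n => hp n n (n + 1) le_rfl n.le_succ
  let s : ℕ → E := fun n => ∑ k ∈ Finset.range n, a k
  have hs : ∀ n, dist (s n) (s (n + 1)) ≤ 2 / 2 / 2 ^ n := by
    intro n
    rw [dist_eq_norm, norm_sub_rev]
    simp only [s, Finset.sum_range_succ, add_sub_cancel_left]
    simpa using (ha n).le
  obtain ⟨z, hz⟩ := cauchySeq_tendsto_of_complete (cauchySeq_of_le_geometric_two hs)
  have hsz : ∀ n, ‖s n - z‖ ≤ 2 / 2 ^ n := fun n => by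
    rw [← dist_eq_norm]
    exact dist_le_of_le_geometric_two_of_tendsto hs hz n
  have hz2 : ‖z‖ ≤ 2 := by simpa [s] using hsz 0
  have hs4 : ∀ n, ‖s n‖ ≤ 4 := fun n => by
    have h1 := norm_add_le (s n - z) z
    rw [sub_add_cancel] at h1
    have h2 : (2 : ℝ) / 2 ^ n ≤ 2 := div_le_self (by norm_num) (one_le_pow₀ (by norm_num))
    linarith [hsz n]
  have step : ∀ (n : ℕ) (x : E), ‖x‖ ≤ n → (p (n + 1)).1 (x + s (n + 1)) = (p n).1 (x + s n) := by
    intro n x hx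
    have h : (p n).1 (x + s n) = (p (n + 1)).1 (x + s n + a n) :=
      hpa n (x + s n) ((norm_add_le _ _).trans (by linarith [hs4 n]))
    rw [h]
    simp only [s, Finset.sum_range_succ, add_assoc]
  have stab : ∀ (x : E) (m n : ℕ), ‖x‖ ≤ n → n ≤ m →
      (p m).1 (x + s m) = (p n).1 (x + s n) := by
    intro x m n hx hnm
    induction m, hnm using Nat.le_induction with
    | base => rfl
    | succ m hm ih => rw [step m x (hx.trans (by exact_mod_cast hm)), ih]
  -- The values `p n (x + s n)` are constant once `n ≥ ‖x‖`. The limit takes these values, recentred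
  -- by the limit `z` of the translations.
  let Q : Pattern E S := fun y => (p ⌈‖y - z‖⌉₊).1 (y - z + s ⌈‖y - z‖⌉₊)
  have hQ : ∀ (n : ℕ) (y : E), ‖y - z‖ ≤ n → Q y = (p n).1 (y + (s n - z)) := by
    intro n y hy
    rw [show y + (s n - z) = y - z + s n by abel,
      stab (y - z) n ⌈‖y - z‖⌉₊ (Nat.le_ceil _) (Nat.ceil_le.2 hy)]
  have hQΩ : Q ∈ Ω := by
    refine hΩ.mem_of_ball fun R => ?_
    obtain ⟨n, hn⟩ := exists_nat_ge (R + ‖z‖)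
    exact ⟨p n, (p n).2, s n - z, fun x hx => hQ n x ((norm_sub_le _ _).trans (by linarith))⟩
  refine ⟨⟨Q, hQΩ⟩, Uniform.tendsto_nhds_left.2 fun V hV => Filter.mem_map.2 ?_⟩
  obtain ⟨R, e, he, h⟩ := mem_uniformity_subtype_iff_near.1 hV
  have h1 : ∀ᶠ n in Filter.atTop, dist (s n) z < e := Metric.tendsto_nhds.1 hz e he
  filter_upwards [h1, Filter.eventually_ge_atTop ⌈R + 4⌉₊] with n hn hnR
  refine h _ _ ⟨z - s n, by rwa [norm_sub_rev, ← dist_eq_norm], fun x hx => ?_⟩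
  change _ = Q _
  rw [hQ n]
  · exact congrArg _ (by abel)
  · rw [show x + (z - s n) - z = x - s n by abel]
    exact (norm_sub_le _ _).trans (by linarith [hs4 n, Nat.ceil_le.1 hnR])

theorem IsFLC.compactSpace {Ω : Set (Pattern E S)} (hΩ : IsPatternSpace Ω) (h : IsFLC Ω) :
    CompactSpace Ω := by
  have : ProperSpace E := FiniteDimensional.proper ℝ E
  have := hΩ.completeSpace
  refine ⟨isCompact_iff_totallyBounded_isComplete.2 ⟨?_, isComplete_univ⟩⟩
  rw [totallyBounded_iff_ultrafilter]
  rintro f -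
  rw [cauchy_iff]
  refine ⟨f.neBot, fun s hs => ?_⟩
  obtain ⟨R, e, he, hs⟩ := mem_uniformity_subtype_iff_near.1 hs
  obtain ⟨n, P, K, hK, hPK⟩ := h (Metric.closedBall 0 (R + e)) (isCompact_closedBall _ _)
  have hPK' : ∀ Q : Ω, ∃ i, ∃ y ∈ K i, ∀ x : E, ‖x‖ ≤ R + e → Q.1 x = P i (y + x) := by
    intro Q
    obtain ⟨i, y, hy, hQ⟩ := hPK Q.1 Q.2 0
    refine ⟨i, y, hy, fun x hx => ?_⟩
    have := patch_eq_iff.1 hQ x (by simpa using hx)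
    simpa using this
  choose i y hy hQ using hPK'
  -- Along the ultrafilter the model pattern is constant and the position in it converges, so
  -- patterns in one member of the filter differ by a short translation.
  obtain ⟨j, hj⟩ : ∃ j, ∀ᶠ Q in (f : Filter Ω), i Q = j := by
    have := (f.map i).eq_pure_of_finite
    obtain ⟨j, hj⟩ := this
    refine ⟨j, ?_⟩
    have : {j} ∈ f.map i := by rw [hj]; exact Filter.singleton_mem_pure
    exact this
  obtain ⟨y₀, -, hy₀⟩ := (hK j).ultrafilter_le_nhds (f.map y) (by
    rw [Filter.le_principal_iff]
    refine Filter.mem_map.2 ?_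
    filter_upwards [hj] with Q hQj
    exact hQj ▸ hy Q)
  have hball : ∀ᶠ Q in (f : Filter Ω), y Q ∈ Metric.ball y₀ (e / 2) :=
    hy₀ (Metric.ball_mem_nhds _ (by positivity))
  refine ⟨_, hj.and hball, ?_⟩
  rintro ⟨Q, Q'⟩ ⟨⟨h1, h2⟩, h3, h4⟩
  rw [mem_ball_iff_norm] at h2 h4
  have hn : ‖y Q - y Q'‖ < e := by
    have := norm_sub_le (y Q - y₀) (y Q' - y₀)
    rw [sub_sub_sub_cancel_right] at this
    linarith
  refine hs Q Q' ⟨y Q - y Q', hn, fun x hx => ?_⟩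
  rw [hQ Q x (by linarith), hQ Q' _ ((norm_add_le _ _).trans (by linarith)),
    show i Q = i Q' from h1.trans h3.symm]
  congr 1
  abel

theorem IsPatternSpace.isFLC {Ω : Set (Pattern E S)} (hΩ : IsPatternSpace Ω) [CompactSpace Ω] :
    IsFLC Ω := by
  have : ProperSpace E := FiniteDimensional.proper ℝ E
  intro U hU
  obtain ⟨R, hR⟩ := hU.isBounded.exists_norm_le
  obtain ⟨t, ht, hcov⟩ := (isCompact_univ (X := Ω)).totallyBounded _
    (near_mem_uniformity (Ω := Ω) R one_pos)
  refine ⟨ht.toFinset.card, fun i => (ht.toFinset.equivFin.symm i).1.1,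
    fun _ => Metric.closedBall 0 1, fun _ => isCompact_closedBall _ _, fun Q hQ x => ?_⟩
  have := hcov (mem_univ ⟨shift x Q, hΩ.shift_mem hQ x⟩)
  simp only [mem_iUnion] at this
  obtain ⟨P, hP, a, ha, hPa⟩ := this
  refine ⟨ht.toFinset.equivFin ⟨P, ht.mem_toFinset.2 hP⟩, a, by simpa using ha.le, ?_⟩
  rw [patch_eq_iff]
  intro u hu
  simp only [Equiv.symm_apply_apply]
  rw [add_comm x, add_comm a]
  exact hPa u (hR u hu)

theorem IsWellSeparated.t2Space {Ω : Set (Pattern E S)} (hΩ : IsPatternSpace Ω)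
    (h : IsWellSeparated Ω) : T2Space Ω := by
  refine t2Space_of_forall_near fun P Q hPQ => ?_
  obtain ⟨V, hV, h⟩ := h
  obtain ⟨R, hR⟩ := hV.isBounded.exists_norm_le
  apply Subtype.ext
  funext x
  by_contra hne
  obtain ⟨B, hB, hBV⟩ := h _ (hΩ.shift_mem P.2 x) _ (hΩ.shift_mem Q.2 x) (by simpa using hne)
  obtain ⟨e, he, heB⟩ := Metric.mem_nhds_iff.1 hB
  obtain ⟨a, ha, hx⟩ := hPQ (R + ‖x‖) e he
  refine hBV 0 (mem_of_mem_nhds hB) a (heB (by simpa using ha)) ?_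
  rw [patch_eq_iff]
  intro t ht
  simp only [shift_apply, zero_add]
  rw [hx _ ((norm_add_le _ _).trans (by linarith [hR t ht]))]
  exact congrArg Q.1 (by abel)

end FiniteLocalComplexity

/-! ### Local groups and the lines in their limits -/

section LocalGroups

variable {E : Type u} [NormedAddCommGroup E]

/-- A decreasing family of sets that behave like subgroups of `E`, up to a loss of radius. -/
structure IsLocalGroup (G : ℝ → Set E) : Prop where
  anti : ∀ {r r' : ℝ}, r ≤ r' → G r' ⊆ G r
  zero_mem : ∀ r, (0 : E) ∈ G r
  add_mem : ∀ {r s : ℝ} {z z' : E}, z ∈ G r → z' ∈ G r → ‖z‖ < s → z + z' ∈ G (r - s)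
  neg_mem : ∀ {r s : ℝ} {z : E}, z ∈ G r → ‖z‖ < s → -z ∈ G (r - s)

namespace IsLocalGroup

variable {G : ℝ → Set E}

theorem closure (h : IsLocalGroup G) : IsLocalGroup fun r => closure (G r) where
  anti hr := closure_mono (h.anti hr)
  zero_mem r := subset_closure (h.zero_mem r)
  add_mem {r s z z'} hz hz' hs := by
    have hz : z ∈ _root_.closure (Metric.ball 0 s ∩ G r) :=
      Metric.isOpen_ball.inter_closure ⟨by simpa using hs, hz⟩
    refine map_mem_closure₂ continuous_add hz hz' ?_
    rintro a ⟨ha, ha'⟩ b hb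
    exact h.add_mem ha' hb (by simpa using ha)
  neg_mem {r s z} hz hs := by
    have hz : z ∈ _root_.closure (Metric.ball 0 s ∩ G r) :=
      Metric.isOpen_ball.inter_closure ⟨by simpa using hs, hz⟩
    refine map_mem_closure continuous_neg hz ?_
    rintro a ⟨ha, ha'⟩
    exact h.neg_mem ha' (by simpa using ha)

theorem nsmul_mem (h : IsLocalGroup G) {r s : ℝ} {z : E} (hz : z ∈ G r) (hs : ‖z‖ < s) (k : ℕ) :
    k • z ∈ G (r - k * s) := by
  have hs0 : 0 < s := (norm_nonneg z).trans_lt hs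
  induction k with
  | zero => simpa using h.zero_mem r
  | succ k ih =>
    rw [succ_nsmul']
    refine h.anti ?_ (h.add_mem (h.anti ?_ hz) ih hs)
    · push_cast
      linarith
    · have : 0 ≤ k * s := by positivity
      linarith

variable [NormedSpace ℝ E]

/-- The space of directions in which the closures of all the sets `G r` contain a whole line. -/
def limitSpace (h : IsLocalGroup G) : Submodule ℝ E where
  carrier := {v | ∀ t r : ℝ, t • v ∈ _root_.closure (G r)}
  zero_mem' t r := by
    rw [smul_zero]
    exact h.closure.zero_mem r
  add_mem' {v w} hv hw t r := by
    rw [smul_add]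
    exact h.closure.anti (by linarith)
      (h.closure.add_mem (hv t (r + (‖t • v‖ + 1))) (hw t _) (lt_add_one _))
  smul_mem' c v hv t r := by
    rw [smul_smul]
    exact hv _ r

theorem mem_closure_of_mem_limitSpace (h : IsLocalGroup G) {v : E} (hv : v ∈ h.limitSpace)
    (r : ℝ) : v ∈ _root_.closure (G r) := by
  simpa using hv 1 r

variable [FiniteDimensional ℝ E]

/-- The small elements of `G r`, for large `r`, lie in the limit space. -/
theorem exists_mem_limitSpace (h : IsLocalGroup G) :
    ∃ R e : ℝ, 0 < R ∧ 0 < e ∧ ∀ z ∈ _root_.closure (G R), ‖z‖ < e → z ∈ h.limitSpace := by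
  have : ProperSpace E := FiniteDimensional.proper ℝ E
  by_contra! hcon
  choose z hzG hz hzV using fun n : ℕ => hcon (n + 1) (1 / ((n : ℝ) + 1))
    (by positivity) (by positivity)
  -- As for closed subgroups of `ℝⁿ`: project short elements outside the limit space to a complement
  -- `W`. A limit of their directions is a unit vector of `W` whose line lies in every closure,
  -- hence in the limit space too.
  obtain ⟨W, hW⟩ := h.limitSpace.exists_isCompl
  let p : E →L[ℝ] E := (W.subtype ∘ₗ W.projectionOnto h.limitSpace hW.symm).toContinuousLinearMap
  have hpW : ∀ x, p x ∈ W := fun x => (W.projectionOnto h.limitSpace hW.symm x).2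
  have hpV : ∀ x, p x - x ∈ h.limitSpace := fun x => by
    rw [← Submodule.ker_projectionOnto hW.symm, LinearMap.mem_ker, map_sub, sub_eq_zero]
    exact Submodule.projectionOnto_apply_left hW.symm _
  have hz0 : Filter.Tendsto z Filter.atTop (𝓝 0) :=
    squeeze_zero_norm (fun n => (hz n).le) tendsto_one_div_add_atTop_nhds_zero_nat
  have hw0 : Filter.Tendsto (fun n => ‖p (z n)‖) Filter.atTop (𝓝 0) := by
    have := (p.continuous.tendsto 0).comp hz0
    rw [map_zero] at this
    simpa using this.norm
  have hwne : ∀ n, p (z n) ≠ 0 := fun n hn => by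
    have := hpV (z n)
    rw [hn, zero_sub, neg_mem_iff] at this
    exact hzV n this
  have hwpos : ∀ n, 0 < ‖p (z n)‖ := fun n => norm_pos_iff.2 (hwne n)
  have hwG : ∀ n : ℕ, p (z n) ∈ _root_.closure (G (n - 1)) := fun n => by
    have h1 := h.closure.add_mem (h.closure.anti (by linarith) (hzG n)) (h.mem_closure_of_mem_limitSpace (hpV (z n)) n)
      (s := 1) ((hz n).trans_le (by
        rw [div_le_one (by positivity)]
        linarith [(n.cast_nonneg : (0 : ℝ) ≤ n)]))
    rwa [add_sub_cancel] at h1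
  let l : Ultrafilter ℕ := Filter.hyperfilter ℕ
  have hl : (l : Filter ℕ) ≤ Filter.atTop := Nat.hyperfilter_le_atTop
  obtain ⟨y, hy, hly⟩ := (isCompact_sphere (0 : E) 1).ultrafilter_le_nhds
    (l.map fun n => ‖p (z n)‖⁻¹ • p (z n)) (by
      rw [Filter.le_principal_iff]
      refine Filter.mem_map.2 (Filter.univ_mem' fun n => ?_)
      simp [norm_smul, (hwpos n).ne'])
  have hly : Filter.Tendsto (fun n => ‖p (z n)‖⁻¹ • p (z n)) l (𝓝 y) := hly
  have hyW : y ∈ W := by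
    have hc : IsClosed (W : Set E) := W.closed_of_finiteDimensional
    exact hc.mem_of_tendsto hly (Filter.Eventually.of_forall fun n => W.smul_mem _ (hpW _))
  -- The multiples of `p (z n)` by `⌊t / ‖p (z n)‖⌋` tend to `t • y`. Their total length is at most
  -- `t`, so the loss of radius is at most `2 * t`, however many summands there are.
  have key : ∀ t : ℝ, 0 ≤ t → ∀ r, t • y ∈ _root_.closure (G r) := by
    intro t ht r
    have hk : Filter.Tendsto (fun n => (⌊t / ‖p (z n)‖⌋₊ : ℝ) * ‖p (z n)‖) l (𝓝 t) := by
      rw [tendsto_iff_norm_sub_tendsto_zero]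
      refine squeeze_zero (fun _ => norm_nonneg _) (fun n => ?_) (hw0.mono_left hl)
      have h1 := Nat.floor_le (div_nonneg ht (hwpos n).le)
      have h2 := Nat.lt_floor_add_one (t / ‖p (z n)‖)
      rw [le_div_iff₀ (hwpos n)] at h1
      rw [div_lt_iff₀ (hwpos n)] at h2
      rw [Real.norm_eq_abs, abs_le]
      constructor <;> linarith
    have hlim := hk.smul hly
    refine isClosed_closure.mem_of_tendsto hlim ?_
    have hev : ∀ᶠ n : ℕ in (l : Filter ℕ), r + 1 + 2 * t ≤ n :=
      hl.trans (tendsto_natCast_atTop_atTop (R := ℝ)).le_comap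
        (Filter.preimage_mem_comap (Filter.Ici_mem_atTop _))
    filter_upwards [hev] with n hn
    have h1 := Nat.floor_le (div_nonneg ht (hwpos n).le)
    rw [le_div_iff₀ (hwpos n)] at h1
    have h2 := h.closure.nsmul_mem (hwG n) (s := 2 * ‖p (z n)‖) (by linarith [hwpos n])
      ⌊t / ‖p (z n)‖⌋₊
    rw [smul_smul, mul_assoc, mul_inv_cancel₀ (hwpos n).ne', mul_one, Nat.cast_smul_eq_nsmul]
    refine h.closure.anti ?_ h2
    linarith
  have hyV : y ∈ h.limitSpace := by
    intro t r
    rcases le_total 0 t with ht | ht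
    · exact key t ht r
    · have h1 := h.closure.neg_mem (key (-t) (by linarith) (r + (‖(-t) • y‖ + 1))) (lt_add_one _)
      rw [neg_smul, neg_neg] at h1
      exact h.closure.anti (by linarith) h1
  have hy0 : y = 0 := by
    have := Submodule.disjoint_def.1 hW.disjoint y hyV hyW
    exact this
  rw [hy0] at hy
  simp at hy

end IsLocalGroup

end LocalGroups

/-! ### Local periods of a single pattern -/

section LocalPeriods

variable {E : Type u} [NormedAddCommGroup E] {S : Type v}

/-- The vectors that are eventually periods, on the ball of radius `r`, of the members of a
sequence of patterns. -/
def eventualPeriods (F : ℕ → Pattern E S) (r : ℝ) : Set E :=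
  {z | ∀ᶠ n in Filter.atTop, ∀ x : E, ‖x‖ ≤ r → F n (x + z) = F n x}

theorem isLocalGroup_eventualPeriods (F : ℕ → Pattern E S) :
    IsLocalGroup (eventualPeriods F) where
  anti hr z hz := hz.mono fun n hn x hx => hn x (hx.trans hr)
  zero_mem r := Filter.Eventually.of_forall fun n x _ => by rw [add_zero]
  add_mem {r s z z'} hz hz' hs := by
    filter_upwards [hz, hz'] with n hn hn' x hx
    rw [← add_assoc, hn' _ ((norm_add_le _ _).trans (by linarith)), hn]
    linarith [norm_nonneg z]
  neg_mem {r s z} hz hs := by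
    filter_upwards [hz] with n hn x hx
    have := hn (x + -z) ((norm_add_le _ _).trans (by rw [norm_neg]; linarith))
    rw [neg_add_cancel_right] at this
    exact this.symm

theorem mem_eventualPeriods_const {P : Pattern E S} {r : ℝ} {z : E} :
    z ∈ eventualPeriods (fun _ => P) r ↔ ∀ x : E, ‖x‖ ≤ r → P (x + z) = P x :=
  Filter.eventually_const

variable [NormedSpace ℝ E]

/-- The largest linear subspace contained in the group of periods. -/
def periodSpace (P : Pattern E S) : Submodule ℝ E where
  carrier := {v | ∀ t : ℝ, t • v ∈ periods P}
  zero_mem' t := by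
    rw [smul_zero]
    exact zero_mem _
  add_mem' hv hw t := by
    rw [smul_add]
    exact add_mem (hv t) (hw t)
  smul_mem' c v hv t := by
    rw [smul_smul]
    exact hv _

theorem mem_periodSpace {P : Pattern E S} {v : E} :
    v ∈ periodSpace P ↔ ∀ t : ℝ, t • v ∈ periods P := Iff.rfl

theorem mem_periods_of_mem_periodSpace {P : Pattern E S} {v : E} (hv : v ∈ periodSpace P) :
    v ∈ periods P := by
  simpa using hv 1

variable [FiniteDimensional ℝ E] {Ω : Set (Pattern E S)}

/-- If `v` is a limit of local periods on every ball, then `P` and its translate by `v` are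
arbitrarily near, hence equal by the Hausdorff property. -/
theorem limitSpace_const_le (hΩ : IsPatternSpace Ω) [T2Space Ω] (P : Ω) :
    (isLocalGroup_eventualPeriods fun _ => P.1).limitSpace ≤ periodSpace P.1 := by
  intro v hv t
  rw [mem_periods_iff]
  have : P = ⟨shift (t • v) P.1, hΩ.shift_mem P.2 _⟩ := by
    refine eq_of_forall_near _ _ fun R e he => ?_
    obtain ⟨z, hz, hze⟩ := Metric.mem_closure_iff.1 (hv t R) e he
    rw [mem_eventualPeriods_const] at hz
    refine ⟨z - t • v, by rwa [norm_sub_rev, ← dist_eq_norm], fun x hx => ?_⟩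
    rw [← hz x hx]
    exact congrArg P.1 (by abel)
  intro x
  have h2 := congrFun (congrArg Subtype.val this) x
  exact h2.symm

/-- The small local periods of an element of a Hausdorff pattern space generate lines of
periods. -/
theorem exists_mem_periodSpace (hΩ : IsPatternSpace Ω) [T2Space Ω] (P : Ω) :
    ∃ R e : ℝ, 0 < R ∧ 0 < e ∧
      ∀ z : E, ‖z‖ < e → (∀ x : E, ‖x‖ ≤ R → P.1 (x + z) = P.1 x) → z ∈ periodSpace P.1 := by
  obtain ⟨R, e, hR, he, h⟩ := (isLocalGroup_eventualPeriods fun _ => P.1).exists_mem_limitSpace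
  exact ⟨R, e, hR, he, fun z hz hx => limitSpace_const_le hΩ P
    (h z (subset_closure (mem_eventualPeriods_const.2 hx)) hz)⟩

end LocalPeriods

/-! ### Consequences of compactness and the Hausdorff property -/

section CompactHausdorff

theorem eventually_hyperfilter_ge (R : ℝ) :
    ∀ᶠ n : ℕ in (Filter.hyperfilter ℕ : Filter ℕ), R ≤ n :=
  Nat.hyperfilter_le_atTop
    (tendsto_natCast_atTop_atTop.eventually (Filter.eventually_ge_atTop R))

variable {E : Type u} [NormedAddCommGroup E] {S : Type v}

theorem Near.trans {R e e' : ℝ} {P Q T : Pattern E S} (h : Near R e P Q)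
    (h' : Near (R + e) e' Q T) : Near R (e + e') P T := by
  obtain ⟨a, ha, hPQ⟩ := h
  obtain ⟨b, hb, hQT⟩ := h'
  refine ⟨a + b, (norm_add_le _ _).trans_lt (by linarith), fun x hx => ?_⟩
  rw [hPQ x hx, hQT _ ((norm_add_le _ _).trans (by linarith))]
  exact congrArg T (by abel)

variable [NormedSpace ℝ E] [FiniteDimensional ℝ E] {Ω : Set (Pattern E S)}

theorem IsPatternSpace.isWellSeparated (hΩ : IsPatternSpace Ω) [CompactSpace Ω] [T2Space Ω] :
    IsWellSeparated Ω := by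
  have : ProperSpace E := FiniteDimensional.proper ℝ E
  by_contra hcon
  have hcon' : ∀ n : ℕ, ∃ P Q : Ω, P.1 0 ≠ Q.1 0 ∧
      ∀ δ : ℝ, 0 < δ → δ ≤ 1 → Near (n - 1) δ P.1 Q.1 := by
    intro n
    by_contra! h
    refine hcon ⟨Metric.closedBall 0 n, isCompact_closedBall _ _, fun P hP Q hQ hPQ => ?_⟩
    obtain ⟨δ, hδ, hδ1, hN⟩ := h ⟨P, hP⟩ ⟨Q, hQ⟩ hPQ
    refine ⟨Metric.ball 0 (δ / 2), Metric.ball_mem_nhds _ (by positivity),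
      fun b hb b' hb' hbb => hN ?_⟩
    rw [mem_ball_zero_iff] at hb hb'
    rw [patch_eq_iff] at hbb
    refine ⟨b' - b, (norm_sub_le _ _).trans_lt (by linarith), fun x hx => ?_⟩
    have h1 := hbb (x - b) (by
      rw [mem_closedBall_zero_iff]
      exact (norm_sub_le _ _).trans (by linarith))
    rw [add_sub_cancel] at h1
    exact h1.trans (congrArg Q (by abel))
  choose p q hpq hnear using hcon'
  obtain ⟨P, hP⟩ := exists_eventually_near (Filter.hyperfilter ℕ) p
  obtain ⟨Q, hQ⟩ := exists_eventually_near (Filter.hyperfilter ℕ) q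
  have hPQ : P = Q := by
    refine eq_of_forall_near P Q fun R e he => ?_
    let δ := min (e / 3) 1
    have hδ : 0 < δ := by positivity
    have hδe : δ ≤ e / 3 := min_le_left _ _
    have hδ1 : δ ≤ 1 := min_le_right _ _
    obtain ⟨n, h1, h2, h3⟩ :=
      ((hP (R + 1) δ hδ).and ((hQ (R + 2) δ hδ).and (eventually_hyperfilter_ge (R + 5)))).exists
    have h4 := ((h1.symm.mono (by linarith) le_rfl : Near R δ _ _).trans
      ((hnear n δ hδ hδ1).mono (by linarith) le_rfl)).trans (h2.mono (by linarith) le_rfl)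
    exact h4.mono le_rfl (by linarith)
  subst hPQ
  obtain ⟨R, e, hR, he, hV⟩ := exists_mem_periodSpace hΩ P
  let δ := min (e / 3) 1
  have hδ : 0 < δ := by positivity
  have hδe : δ ≤ e / 3 := min_le_left _ _
  have hδ1 : δ ≤ 1 := min_le_right _ _
  obtain ⟨n, ⟨a, ha, hPa⟩, ⟨b, hb, hQb⟩, hn⟩ :=
    ((hP (R + 5) δ hδ).and ((hQ (R + 5) δ hδ).and (eventually_hyperfilter_ge (R + 5)))).exists
  have hba : b - a ∈ periodSpace P.1 := by
    have hc : IsClosed (periodSpace P.1 : Set E) := Submodule.closed_of_finiteDimensional _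
    change b - a ∈ (periodSpace P.1 : Set E)
    rw [← hc.closure_eq, Metric.mem_closure_iff]
    intro ε hε
    -- For this fixed `n` the translation `c` between `p n` and `q n` may be arbitrarily short, so
    -- the local periods `b - a + c` of `P` converge to `b - a`, and the period space is closed.
    obtain ⟨c, hc, hcx⟩ := hnear n (min δ ε) (by positivity) ((min_le_left _ _).trans hδ1)
    have hcδ := hc.trans_le (min_le_left _ _)
    have hcε := hc.trans_le (min_le_right _ _)
    refine ⟨b - a + c, hV _ ?_ fun x hx => ?_, by simpa using hcε⟩
    · have h1 := norm_add_le (b - a) c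
      have h2 := norm_sub_le b a
      linarith
    · have hxa : ‖x - a‖ ≤ R + 1 := (norm_sub_le _ _).trans (by linarith)
      have h1 : (p n).1 (x - a) = P.1 (x - a + a) := hPa _ (by linarith)
      have h2 : (p n).1 (x - a) = (q n).1 (x - a + c) := hcx _ (by linarith)
      have h3 : (q n).1 (x - a + c) = P.1 (x - a + c + b) :=
        hQb _ ((norm_add_le _ _).trans (by linarith))
      rw [sub_add_cancel] at h1
      rw [← h1, h2, h3]
      exact congrArg P.1 (by abel)
  refine hpq n ?_
  have h1 : (p n).1 0 = P.1 (0 + a) := hPa 0 (by rw [norm_zero]; linarith)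
  have h2 : (q n).1 0 = P.1 (0 + b) := hQb 0 (by rw [norm_zero]; linarith)
  rw [h1, h2, ← mem_periods_iff.1 (mem_periods_of_mem_periodSpace hba) (0 + a)]
  exact congrArg P.1 (by abel)

/-- Return vectors tending to 0 would become short local periods of a limit pattern, hence elements
of its zero period space. -/
theorem IsPatternSpace.isReturnDiscrete (hΩ : IsPatternSpace Ω) [CompactSpace Ω] [T2Space Ω]
    (h : ∀ P ∈ Ω, periodSpace P = ⊥) : IsReturnDiscrete Ω := by
  have : ProperSpace E := FiniteDimensional.proper ℝ E
  by_contra hcon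
  have hcon' : ∀ n : ℕ, ∃ P : Ω, ∃ b : E, ‖b‖ < 1 / ((n : ℝ) + 1) ∧ b ≠ 0 ∧
      ∀ x : E, ‖x‖ ≤ n → P.1 (x + b) = P.1 x := by
    intro n
    by_contra! hn
    refine hcon ⟨Metric.ball 0 (1 / ((n : ℝ) + 1)), Metric.ball_mem_nhds _ (by positivity),
      Metric.closedBall 0 n, isCompact_closedBall _ _, fun P hP b hb hPb => ?_⟩
    by_contra hb0
    obtain ⟨x, hx, hne⟩ := hn ⟨P, hP⟩ b (by simpa using hb) hb0
    have h1 := patch_eq_iff.1 hPb x (by simpa using hx)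
    rw [zero_add, add_comm] at h1
    exact hne h1.symm
  choose p b hb hb0 hpb using hcon'
  obtain ⟨P, hP⟩ := exists_eventually_near (Filter.hyperfilter ℕ) p
  obtain ⟨R, e, hR, he, hV⟩ := exists_mem_periodSpace hΩ P
  obtain ⟨n, ⟨a, ha, hPa⟩, hn, hne⟩ := ((hP (R + 2) 1 one_pos).and
    ((eventually_hyperfilter_ge (R + 5)).and (eventually_hyperfilter_ge (1 / e)))).exists
  have hb1 : ‖b n‖ ≤ 1 := (hb n).le.trans (by
    rw [div_le_one (by positivity)]
    linarith)
  have hbe : ‖b n‖ < e := (hb n).trans_le (by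
    rw [div_le_iff₀ he] at hne
    rw [div_le_iff₀ (by positivity)]
    linarith)
  have h1 := hV (b n) hbe fun x hx => by
    have hxa : ‖x - a‖ ≤ R + 1 := (norm_sub_le _ _).trans (by linarith)
    have h1 : (p n).1 (x - a) = P.1 (x - a + a) := hPa _ (by linarith)
    have h2 : (p n).1 (x - a + b n) = P.1 (x - a + b n + a) :=
      hPa _ ((norm_add_le _ _).trans (by linarith))
    rw [sub_add_cancel] at h1
    rw [← h1, ← hpb n (x - a) (by linarith), h2]
    exact congrArg P.1 (by abel)
  rw [h P.1 P.2, Submodule.mem_bot] at h1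
  exact hb0 n h1

omit [NormedSpace ℝ E] [FiniteDimensional ℝ E] in
theorem IsReturnDiscrete.discreteTopology (h : IsReturnDiscrete Ω) {P : Pattern E S}
    (hP : P ∈ Ω) : DiscreteTopology (periods P) := by
  obtain ⟨B, hB, V, -, h⟩ := h
  obtain ⟨e, he, heB⟩ := Metric.mem_nhds_iff.1 hB
  refine discreteTopology_of_isOpen_singleton_zero (Metric.isOpen_singleton_iff.2 ⟨e, he, ?_⟩)
  rintro ⟨z, hz⟩ hze
  refine Subtype.ext (h P hP z (heB hze) (patch_eq_iff.2 fun t _ => ?_))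
  rw [zero_add, add_comm, mem_periods_iff.1 hz]

omit [FiniteDimensional ℝ E] in
theorem periodSpace_eq_bot (P : Pattern E S) [DiscreteTopology (periods P)] :
    periodSpace P = ⊥ := by
  obtain ⟨e, he, h⟩ := Metric.isOpen_singleton_iff.1 (isOpen_discrete ({0} : Set (periods P)))
  rw [Submodule.eq_bot_iff]
  intro v hv
  by_contra hv0
  have hpos : 0 < ‖v‖ := norm_pos_iff.2 hv0
  have h1 := h ⟨(e / (2 * ‖v‖)) • v, hv _⟩ (by
    rw [Subtype.dist_eq, dist_eq_norm]
    simp only [ZeroMemClass.coe_zero, sub_zero]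
    rw [norm_smul, Real.norm_of_nonneg (by positivity), div_mul_eq_mul_div,
      div_lt_iff₀ (by positivity)]
    nlinarith)
  have h2 := congrArg Subtype.val h1
  simp only [ZeroMemClass.coe_zero, smul_eq_zero, hv0, or_false] at h2
  have : 0 < e / (2 * ‖v‖) := by positivity
  exact this.ne' h2

theorem exists_pos_forall_mem_periodSpace (hΩ : IsPatternSpace Ω) [CompactSpace Ω] [T2Space Ω] :
    ∃ e : ℝ, 0 < e ∧ ∀ P ∈ Ω, ∀ z ∈ periods P, ‖z‖ < e → z ∈ periodSpace P := by
  by_contra! hcon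
  have hcon' : ∀ n : ℕ, ∃ P : Ω, ∃ z : E, ‖z‖ < 1 / ((n : ℝ) + 1) ∧ z ∈ periods P.1 ∧
      ∃ t : ℝ, |t| ≤ 1 ∧ P.1 (t • z) ≠ P.1 0 := by
    intro n
    obtain ⟨P, hP, z, hz, hzn, hzV⟩ := hcon (1 / ((n : ℝ) + 1)) (by positivity)
    rw [mem_periodSpace] at hzV
    push Not at hzV
    obtain ⟨t, ht⟩ := hzV
    -- Integer multiples of a period are periods, so the failing multiple can be taken in `[0, 1)`.
    -- After recentring it stays in a fixed ball, where nearness to the limit controls it.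
    have ht' : Int.fract t • z ∉ periods P := fun h => ht (by
      rw [← Int.floor_add_fract t, add_smul, Int.cast_smul_eq_zsmul]
      exact add_mem (zsmul_mem hz _) h)
    rw [mem_periods_iff] at ht'
    push Not at ht'
    obtain ⟨x, hx⟩ := ht'
    refine ⟨⟨shift x P, hΩ.shift_mem hP x⟩, z, hzn, ?_, Int.fract t, ?_, ?_⟩
    · rw [mem_periods_iff] at hz ⊢
      intro y
      change P (y + z + x) = P (y + x)
      rw [← hz (y + x)]
      exact congrArg P (by abel)
    · rw [abs_of_nonneg (Int.fract_nonneg t)]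
      exact (Int.fract_lt_one t).le
    · change P (_ + x) ≠ P (0 + x)
      rwa [zero_add, add_comm]
  choose p z hz hzp t ht hpt using hcon'
  obtain ⟨P, hP⟩ := exists_eventually_near (Filter.hyperfilter ℕ) p
  obtain ⟨R, e, hR, he, hV⟩ := exists_mem_periodSpace hΩ P
  obtain ⟨n, ⟨a, ha, hPa⟩, hn, hne⟩ := ((hP (R + 2) 1 one_pos).and
    ((eventually_hyperfilter_ge (R + 5)).and (eventually_hyperfilter_ge (1 / e)))).exists
  have hz1 : ‖z n‖ ≤ 1 := (hz n).le.trans (by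
    rw [div_le_one (by positivity)]
    linarith)
  have hze : ‖z n‖ < e := (hz n).trans_le (by
    rw [div_le_iff₀ he] at hne
    rw [div_le_iff₀ (by positivity)]
    linarith)
  have h1 := hV (z n) hze fun x hx => by
    have hxa : ‖x - a‖ ≤ R + 1 := (norm_sub_le _ _).trans (by linarith)
    have h1 : (p n).1 (x - a) = P.1 (x - a + a) := hPa _ (by linarith)
    have h2 : (p n).1 (x - a + z n) = P.1 (x - a + z n + a) :=
      hPa _ ((norm_add_le _ _).trans (by linarith))
    rw [sub_add_cancel] at h1
    rw [← h1, ← mem_periods_iff.1 (hzp n) (x - a), h2]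
    exact congrArg P.1 (by abel)
  refine hpt n ?_
  have h2 : (p n).1 (t n • z n) = P.1 (t n • z n + a) := hPa _ (by
    rw [norm_smul, Real.norm_eq_abs]
    have := mul_le_mul (ht n) hz1 (norm_nonneg _) zero_le_one
    linarith)
  have h3 : (p n).1 0 = P.1 (0 + a) := hPa 0 (by rw [norm_zero]; linarith)
  rw [h2, h3, zero_add, add_comm, mem_periods_iff.1 (h1 (t n))]

omit [FiniteDimensional ℝ E] in
theorem hasTrivialDiscreteComponent_of_le {P : Pattern E S}
    (h : ∀ z ∈ periods P, z ∈ periodSpace P) : HasTrivialDiscreteComponent (periods P) := by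
  rw [HasTrivialDiscreteComponent, QuotientAddGroup.subsingleton_iff, eq_top_iff]
  rintro ⟨z, hz⟩ -
  let f : ℝ → periods P := fun t => ⟨t • z, h z hz t⟩
  have hf : Continuous f := by fun_prop
  have hc := (isPreconnected_univ.image f hf.continuousOn).subset_connectedComponent
    (x := 0) ⟨0, mem_univ _, Subtype.ext (zero_smul ℝ z)⟩
  exact hc ⟨1, mem_univ _, Subtype.ext (one_smul ℝ z)⟩

/-- Short periods lie in the period space, so it is an open, hence clopen, subgroup of the periods
and contains the component of 0. -/
theorem HasTrivialDiscreteComponent.mem_periodSpace (hΩ : IsPatternSpace Ω) [T2Space Ω]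
    {P : Pattern E S} (hP : P ∈ Ω) (h : HasTrivialDiscreteComponent (periods P)) {z : E}
    (hz : z ∈ periods P) : z ∈ periodSpace P := by
  rw [HasTrivialDiscreteComponent, QuotientAddGroup.subsingleton_iff] at h
  obtain ⟨R, e, -, he, hV⟩ := exists_mem_periodSpace hΩ ⟨P, hP⟩
  let H : AddSubgroup (periods P) := (periodSpace P).toAddSubgroup.comap (periods P).subtype
  have hH : IsOpen (H : Set (periods P)) := by
    refine H.isOpen_of_mem_nhds (g := 0) (Metric.mem_nhds_iff.2 ⟨e, he, fun y hy => ?_⟩)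
    refine hV y ?_ fun x _ => mem_periods_iff.1 y.2 x
    rw [mem_ball_zero_iff] at hy
    exact hy
  have hsub := IsClopen.connectedComponent_subset ⟨H.isClosed_of_isOpen hH, hH⟩ H.zero_mem
  have hzc : (⟨z, hz⟩ : periods P) ∈ AddSubgroup.connectedComponentOfZero (periods P) := by
    rw [h]
    trivial
  exact hsub hzc

end CompactHausdorff

/-! ### Summability of powers from the eigenvalues -/

section Expansion

/-- Gelfand's formula bounds `‖a ^ n‖` eventually by a geometric sequence. -/
theorem summable_norm_pow_of_spectrum {A : Type*} [NormedRing A] [NormedAlgebra ℂ A]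
    [CompleteSpace A] [Nontrivial A] (a : A) (h : ∀ z ∈ spectrum ℂ a, ‖z‖ < 1) :
    Summable fun n : ℕ => ‖a ^ n‖ := by
  have h1 : spectralRadius ℂ a < 1 := by
    simpa using spectrum.spectralRadius_lt_of_forall_lt a (r := 1) fun z hz => h z hz
  obtain ⟨q, hq, hq1⟩ := ENNReal.lt_iff_exists_nnreal_btwn.1 h1
  have hq1' : (q : ℝ) < 1 := by exact_mod_cast hq1
  have h2 := (spectrum.pow_nnnorm_pow_one_div_tendsto_nhds_spectralRadius a).eventually
    (gt_mem_nhds hq)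
  refine summable_of_isBigO_nat (summable_geometric_of_lt_one q.coe_nonneg hq1') ?_
  refine Asymptotics.IsBigO.of_bound 1 ?_
  filter_upwards [h2, Filter.eventually_gt_atTop 0] with n hn hn0
  have hn0' : (0 : ℝ) < n := by exact_mod_cast hn0
  rw [one_div] at hn
  have h3 := (ENNReal.rpow_inv_le_iff hn0').1 hn.le
  rw [ENNReal.rpow_natCast] at h3
  have h4 : ‖a ^ n‖₊ ≤ q ^ n := by exact_mod_cast h3
  have h5 : ‖a ^ n‖ ≤ (q : ℝ) ^ n := by exact_mod_cast h4
  rw [one_mul, norm_norm, Real.norm_of_nonneg (by positivity : (0 : ℝ) ≤ (q : ℝ) ^ n)]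
  exact h5

variable {E : Type u} [NormedAddCommGroup E] [NormedSpace ℝ E] [FiniteDimensional ℝ E]

open scoped Matrix.Norms.Operator in
theorem summable_norm_pow_of_hasEigenvalue (T : E →L[ℝ] E)
    (h : ∀ μ : ℂ, Module.End.HasEigenvalue ((T : E →ₗ[ℝ] E).baseChange ℂ) μ → ‖μ‖ < 1) :
    Summable fun n : ℕ => ‖T ^ n‖ := by
  rcases subsingleton_or_nontrivial E with hE | hE
  · refine summable_zero.congr fun n => ?_
    rw [Subsingleton.elim (T ^ n) 0, norm_zero]
  let b := Module.finBasis ℝ E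
  have : Nonempty (Fin (Module.finrank ℝ E)) := ⟨⟨0, Module.finrank_pos⟩⟩
  -- Gelfand's formula needs a complex algebra. Passing to complex matrices changes norms only by a
  -- constant, since an injective linear map on a finite-dimensional space is bounded below.
  let φ : (E →L[ℝ] E) →ₐ[ℝ] Matrix (Fin (Module.finrank ℝ E)) (Fin (Module.finrank ℝ E)) ℂ :=
    (Algebra.ofId ℝ ℂ).mapMatrix.comp ((LinearMap.toMatrixAlgEquiv b).toAlgHom.comp
      (Module.End.toContinuousLinearMap E).symm.toAlgHom)
  have hφ : Function.Injective φ := by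
    exact (Matrix.map_injective (algebraMap ℝ ℂ).injective).comp
      ((LinearMap.toMatrixAlgEquiv b).injective.comp
        (Module.End.toContinuousLinearMap E).symm.injective)
  obtain ⟨K, -, hK⟩ := φ.toLinearMap.exists_antilipschitzWith (LinearMap.ker_eq_bot.2 hφ)
  have hbd : ∀ f, ‖f‖ ≤ K * ‖φ f‖ := fun f => by
    have := hK.le_mul_dist f 0
    simpa [dist_eq_norm] using this
  have hspec : ∀ z ∈ spectrum ℂ (φ T), ‖z‖ < 1 := by
    intro z hz
    refine h z ?_
    rw [Module.End.hasEigenvalue_iff_mem_spectrum,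
      ← Matrix.spectrum_toLin _ (Algebra.TensorProduct.basis ℂ b)] at *
    have : Matrix.toLin (Algebra.TensorProduct.basis ℂ b) (Algebra.TensorProduct.basis ℂ b) (φ T) =
        (T : E →ₗ[ℝ] E).baseChange ℂ := by
      have h1 : φ T = LinearMap.toMatrix (Algebra.TensorProduct.basis ℂ b) (Algebra.TensorProduct.basis ℂ b)
          ((T : E →ₗ[ℝ] E).baseChange ℂ) := by
        rw [LinearMap.toMatrix_baseChange]
        rfl
      rw [h1, Matrix.toLin_toMatrix]
    rwa [this] at hz
  have hs := summable_norm_pow_of_spectrum (φ T) hspec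
  refine Summable.of_nonneg_of_le (fun _ => norm_nonneg _) (fun n => ?_) (hs.mul_left (K : ℝ))
  rw [← map_pow]
  exact hbd _

end Expansion

/-! ### Propagation of periods along strips -/

section Strips

variable {E : Type u} [NormedAddCommGroup E] [NormedSpace ℝ E] {S : Type v}

/-- Every vector of `V` of norm at most `1` is close to an element of `V` that is a period of `f` on
the ball of radius `10` about `y`, for each centre `y`. -/
def HasDensePeriods (f : Pattern E S) (V : Submodule ℝ E) : Prop :=
  ∀ y : E, ∀ v ∈ V, ‖v‖ ≤ 1 → ∃ u ∈ V, ‖u - v‖ ≤ 1 / 4 ∧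
    ∀ x : E, ‖x‖ ≤ 10 → f (y + x + u) = f (y + x)

/-- The periods in `V` of the restriction of `f` to the strip of points at distance at most `1`
from `y + V`. -/
def stripPeriods (f : Pattern E S) (V : Submodule ℝ E) (y : E) : AddSubgroup E where
  carrier := {u | u ∈ V ∧ ∀ v ∈ V, ∀ w : E, ‖w‖ ≤ 1 → f (y + v + w + u) = f (y + v + w)}
  zero_mem' := ⟨V.zero_mem, fun v _ w _ => by rw [add_zero]⟩
  add_mem' := by
    rintro a b ⟨ha, hfa⟩ ⟨hb, hfb⟩
    refine ⟨V.add_mem ha hb, fun v hv w hw => ?_⟩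
    rw [← hfa v hv w hw, show y + v + w + a = y + (v + a) + w by abel,
      ← hfb (v + a) (V.add_mem hv ha) w hw]
    exact congrArg f (by abel)
  neg_mem' := by
    rintro a ⟨ha, hfa⟩
    refine ⟨V.neg_mem ha, fun v hv w hw => ?_⟩
    rw [show y + v + w + -a = y + (v - a) + w by abel, ← hfa (v - a) (V.sub_mem hv ha) w hw]
    exact congrArg f (by abel)

theorem mem_stripPeriods {f : Pattern E S} {V : Submodule ℝ E} {y u : E} :
    u ∈ stripPeriods f V y ↔
      u ∈ V ∧ ∀ v ∈ V, ∀ w : E, ‖w‖ ≤ 1 → f (y + v + w + u) = f (y + v + w) := Iff.rfl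

theorem norm_sub_div_norm_smul {v : E} {c : ℝ} (hc : 0 ≤ c) (hv : c < ‖v‖) :
    ‖v - (c / ‖v‖) • v‖ = ‖v‖ - c := by
  have h0 : 0 < ‖v‖ := hc.trans_lt hv
  have h1 : v - (c / ‖v‖) • v = (1 - c / ‖v‖) • v := by rw [sub_smul, one_smul]
  have h2 : c / ‖v‖ ≤ 1 := (div_le_one h0).2 hv.le
  rw [h1, norm_smul, Real.norm_of_nonneg (by linarith), sub_mul, one_mul, div_mul_cancel₀ _ h0.ne']

theorem norm_div_norm_smul {v : E} {c : ℝ} (hc : 0 ≤ c) (hv : c < ‖v‖) :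
    ‖(c / ‖v‖) • v‖ = c := by
  have h0 : 0 < ‖v‖ := hc.trans_lt hv
  rw [norm_smul, Real.norm_of_nonneg (by positivity), div_mul_cancel₀ _ h0.ne']

variable {f : Pattern E S} {V : Submodule ℝ E}

/-- A local period near `y + v` carries both points to be compared back towards `y`. Hence a period
near `y` persists along the whole strip. -/
theorem HasDensePeriods.mem_stripPeriods (h : HasDensePeriods f V) {y u : E} (hu : u ∈ V)
    (hu2 : ‖u‖ ≤ 2)
    (hf : ∀ v ∈ V, ‖v‖ ≤ 1 → ∀ w : E, ‖w‖ ≤ 1 → f (y + v + w + u) = f (y + v + w)) :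
    u ∈ stripPeriods f V y := by
  have key : ∀ k : ℕ, ∀ v ∈ V, ‖v‖ ≤ 1 + k / 2 → ∀ w : E, ‖w‖ ≤ 1 →
      f (y + v + w + u) = f (y + v + w) := by
    intro k
    induction k with
    | zero => simpa using hf
    | succ k ih =>
      intro v hv hvk w hw
      rcases le_or_gt ‖v‖ 1 with hv1 | hv1
      · exact hf v hv hv1 w hw
      · have hv34 : (3 / 4 : ℝ) < ‖v‖ := by linarith
        -- A step of length `3/4` towards 0, with error at most `1/4`, shortens `v` by at least
        -- `1/2`.
        obtain ⟨g, hg, hgv, hfg⟩ := h (y + v) (-((3 / 4 / ‖v‖) • v))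
          (V.neg_mem (V.smul_mem _ hv)) (by
            rw [norm_neg, norm_div_norm_smul (by norm_num) hv34]
            norm_num)
        have hvg : ‖v + g‖ ≤ 1 + k / 2 := by
          have h1 := norm_add_le (v - (3 / 4 / ‖v‖) • v) (g - -((3 / 4 / ‖v‖) • v))
          rw [norm_sub_div_norm_smul (by norm_num) hv34] at h1
          rw [show v - (3 / 4 / ‖v‖) • v + (g - -((3 / 4 / ‖v‖) • v)) = v + g by abel] at h1
          push_cast at hvk
          linarith
        have h1 := hfg (w + u) ((norm_add_le _ _).trans (by linarith))
        have h2 := hfg w (by linarith)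
        rw [add_assoc (y + v) w u, ← h1, ← h2,
          show y + v + (w + u) + g = y + (v + g) + w + u by abel,
          ih (v + g) (V.add_mem hv hg) hvg w hw]
        exact congrArg f (by abel)
  refine ⟨hu, fun v hv w hw => ?_⟩
  obtain ⟨k, hk⟩ := exists_nat_ge (2 * ‖v‖)
  exact key k v hv (by linarith) w hw

theorem HasDensePeriods.exists_mem_stripPeriods (h : HasDensePeriods f V) (y : E) {v : E}
    (hv : v ∈ V) (hv1 : ‖v‖ ≤ 1) : ∃ u ∈ stripPeriods f V y, ‖u - v‖ ≤ 1 / 4 := by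
  obtain ⟨u, hu, huv, hfu⟩ := h y v hv hv1
  refine ⟨u, h.mem_stripPeriods hu ?_ fun v' _ hv' w hw => ?_, huv⟩
  · have := norm_add_le (u - v) v
    rw [sub_add_cancel] at this
    linarith
  · rw [add_assoc y v' w]
    exact hfu (v' + w) ((norm_add_le _ _).trans (by linarith))

/-- Strip periods of norm at most 2 are detected on the patch of radius `4 = 1 + 1 + 2`. Longer ones
are sums of such, by repeatedly subtracting a strip period that shortens them by at least `1/2`. -/
theorem HasDensePeriods.stripPeriods_le (h : HasDensePeriods f V) {y y' : E}
    (hyy' : ∀ t : E, ‖t‖ ≤ 4 → f (y + t) = f (y' + t)) :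
    stripPeriods f V y' ≤ stripPeriods f V y := by
  have small : ∀ u ∈ stripPeriods f V y', ‖u‖ ≤ 2 → u ∈ stripPeriods f V y := by
    intro u hu hu2
    refine h.mem_stripPeriods hu.1 hu2 fun v hv hv1 w hw => ?_
    have h1 := hyy' (v + w) ((norm_add_le _ _).trans (by linarith))
    have h2 := hyy' (v + w + u) ((norm_add₃_le).trans (by linarith))
    have h3 := hu.2 v hv w hw
    simp only [← add_assoc] at h1 h2
    rw [h1, h2, h3]
  have key : ∀ k : ℕ, ∀ u ∈ stripPeriods f V y', ‖u‖ ≤ 2 + k / 2 → u ∈ stripPeriods f V y := by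
    intro k
    induction k with
    | zero => simpa using small
    | succ k ih =>
      intro u hu huk
      rcases le_or_gt ‖u‖ 2 with hu2 | hu2
      · exact small u hu hu2
      · have hu34 : (3 / 4 : ℝ) < ‖u‖ := by linarith
        have hn := norm_div_norm_smul (by norm_num) hu34
        obtain ⟨g, hg, hgu⟩ := h.exists_mem_stripPeriods y' (V.smul_mem (3 / 4 / ‖u‖) hu.1) (by
          rw [hn]
          norm_num)
        have hg1 : ‖g‖ ≤ 1 := by
          have := norm_add_le (g - (3 / 4 / ‖u‖) • u) ((3 / 4 / ‖u‖) • u)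
          rw [sub_add_cancel] at this
          linarith
        have hug : ‖u - g‖ ≤ 2 + k / 2 := by
          have h1 := norm_sub_le (u - (3 / 4 / ‖u‖) • u) (g - (3 / 4 / ‖u‖) • u)
          rw [norm_sub_div_norm_smul (by norm_num) hu34, sub_sub_sub_cancel_right] at h1
          push_cast at huk
          linarith
        have := add_mem (ih (u - g) (sub_mem hu hg) hug) (small g hg (by linarith))
        rwa [sub_add_cancel] at this
  intro u hu
  obtain ⟨k, hk⟩ := exists_nat_ge (2 * ‖u‖)
  exact key k u hu (by linarith)

/-- If all patches of radius `4` occur within distance `T` of the origin, then periods of a strip of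
width `T + 1` about `V` are global periods. -/
theorem HasDensePeriods.mem_periods (h : HasDensePeriods f V) {T : ℝ}
    (hT : ∀ y : E, ∃ y' : E, ‖y'‖ ≤ T ∧ ∀ t : E, ‖t‖ ≤ 4 → f (y + t) = f (y' + t)) {u : E}
    (hu : u ∈ V) (hf : ∀ v ∈ V, ∀ x : E, ‖x‖ ≤ T + 1 → f (v + x + u) = f (v + x)) :
    u ∈ periods f := by
  rw [mem_periods_iff]
  intro y
  obtain ⟨y', hy', hyy'⟩ := hT y
  have h1 : u ∈ stripPeriods f V y' := by
    refine ⟨hu, fun v hv w hw => ?_⟩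
    rw [show y' + v + w = v + (y' + w) by abel]
    exact hf v hv _ ((norm_add_le _ _).trans (by linarith))
  have h2 := (h.stripPeriods_le hyy' h1).2 0 V.zero_mem 0 (by simp)
  simpa using h2

/-- Otherwise Riesz's lemma gives a unit vector of `V` at distance at least `1/2` from `V ∩ W`. -/
theorem le_of_dense [FiniteDimensional ℝ E] {V W : Submodule ℝ E}
    (h : ∀ v ∈ V, ‖v‖ ≤ 1 → ∃ u ∈ V, u ∈ W ∧ ‖u - v‖ ≤ 1 / 4) : V ≤ W := by
  let N : Submodule ℝ V := W.comap V.subtype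
  by_contra hVW
  obtain ⟨v, hv, hvW⟩ := Set.not_subset.1 hVW
  obtain ⟨x, hx, hxN⟩ := riesz_lemma (F := N) (Submodule.closed_of_finiteDimensional _)
    ⟨⟨v, hv⟩, hvW⟩ (r := 1 / 2) (by norm_num)
  have hx0 : x ≠ 0 := fun h0 => hx (h0 ▸ N.zero_mem)
  have hxpos : 0 < ‖x‖ := norm_pos_iff.2 hx0
  obtain ⟨u, huV, huW, hu⟩ := h (‖x‖⁻¹ • x.1) (V.smul_mem _ x.2) (by
    rw [norm_smul, norm_inv, norm_norm]
    exact (inv_mul_cancel₀ hxpos.ne').le)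
  have h1 := hxN (‖x‖ • ⟨u, huV⟩) (N.smul_mem _ huW)
  have h2 : ‖x - ‖x‖ • (⟨u, huV⟩ : V)‖ = ‖x‖ * ‖u - ‖x‖⁻¹ • x.1‖ := by
    rw [← norm_norm x, ← norm_smul, norm_norm, smul_sub, smul_smul, mul_inv_cancel₀ hxpos.ne',
      one_smul, norm_sub_rev]
    rfl
  rw [h2] at h1
  nlinarith

end Strips

/-! ### Asymptotic periods of uniformly local sequences -/

section LocalSequences

variable {E : Type u} [NormedAddCommGroup E] {S : Type v} {Ω : Set (Pattern E S)}

/-- A sequence of maps from `Ω` to patterns, all of whose values are determined by patches of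
radius `C` about the same position. -/
def IsLocalSequence (F : ℕ → Ω → Pattern E S) (C : ℝ) : Prop :=
  ∀ (n : ℕ) (P Q : Ω) (x y : E), (∀ t : E, ‖t‖ ≤ C → P.1 (x + t) = Q.1 (y + t)) →
    F n P x = F n Q y

/-- Translation, as a map of a pattern space into itself. -/
def spaceShift (hΩ : IsPatternSpace Ω) (z : E) (P : Ω) : Ω := ⟨shift z P.1, hΩ.shift_mem P.2 z⟩

theorem spaceShift_apply (hΩ : IsPatternSpace Ω) (z : E) (P : Ω) (x : E) :
    (spaceShift hΩ z P).1 x = P.1 (x + z) := rfl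

theorem spaceShift_neg (hΩ : IsPatternSpace Ω) (z : E) (P : Ω) :
    spaceShift hΩ (-z) (spaceShift hΩ z P) = P := by
  refine Subtype.ext (funext fun x => ?_)
  rw [spaceShift_apply, spaceShift_apply, neg_add_cancel_right]

variable {F : ℕ → Ω → Pattern E S} {C : ℝ}

theorem IsLocalSequence.eq_add (hF : IsLocalSequence F C) {P Q : Ω} {R : ℝ} {a : E}
    (h : ∀ x : E, ‖x‖ ≤ R → P.1 x = Q.1 (x + a)) (n : ℕ) (x : E) (hx : ‖x‖ + C ≤ R) :
    F n P x = F n Q (x + a) := by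
  refine hF n P Q _ _ fun t ht => ?_
  rw [h _ ((norm_add_le _ _).trans (by linarith))]
  exact congrArg Q.1 (by abel)

theorem IsLocalSequence.spaceShift (hF : IsLocalSequence F C) (hΩ : IsPatternSpace Ω) (n : ℕ)
    (z : E) (P : Ω) (x : E) : F n (spaceShift hΩ z P) x = F n P (x + z) :=
  hF n _ _ _ _ fun t _ => by
    rw [spaceShift_apply]
    exact congrArg P.1 (by abel)

theorem IsLocalSequence.add_of_mem_periods (hF : IsLocalSequence F C) {P : Ω} {z : E}
    (hz : z ∈ periods P.1) (n : ℕ) (x : E) : F n P (x + z) = F n P x :=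
  hF n _ _ _ _ fun t _ => by
    rw [← mem_periods_iff.1 hz (x + t)]
    exact congrArg P.1 (by abel)

/-- The vectors that are periods of all but finitely many of the patterns `F n P`, on the ball of
radius `r`. -/
abbrev asymptoticPeriods (F : ℕ → Ω → Pattern E S) (P : Ω) : ℝ → Set E :=
  eventualPeriods fun n => F n P

theorem isLocalGroup_asymptoticPeriods (F : ℕ → Ω → Pattern E S) (P : Ω) :
    IsLocalGroup (asymptoticPeriods F P) :=
  isLocalGroup_eventualPeriods _

theorem IsLocalSequence.asymptoticPeriods_of_near (hF : IsLocalSequence F C) {P Q : Ω} {R : ℝ}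
    {a : E} (ha : ‖a‖ ≤ 1) (h : ∀ x : E, ‖x‖ ≤ R + 2 + C → P.1 x = Q.1 (x + a)) {z : E}
    (hz : z ∈ asymptoticPeriods F P (R + 2)) (hz1 : ‖z‖ ≤ 1) : z ∈ asymptoticPeriods F Q R := by
  filter_upwards [hz] with n hn x hx
  have hxa : ‖x - a‖ ≤ R + 1 := (norm_sub_le _ _).trans (by linarith)
  have h1 := hn (x - a) (by linarith)
  have h2 := hF.eq_add h n (x - a) (by linarith)
  have h3 := hF.eq_add h n (x - a + z) (by linarith [norm_add_le (x - a) z])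
  rw [h2, h3, sub_add_cancel] at h1
  rw [← h1]
  exact congrArg (F n Q) (by abel)

variable [NormedSpace ℝ E]

theorem IsLocalGroup.limitSpace_le {G G' : ℝ → Set E} (h : IsLocalGroup G) (h' : IsLocalGroup G')
    (hG : ∀ r, ∃ r', G r' ⊆ G' r) : h.limitSpace ≤ h'.limitSpace := by
  intro v hv t r
  obtain ⟨r', hr'⟩ := hG r
  exact closure_mono hr' (hv t r')

/-- The space of limits of asymptotic periods of `P`. -/
def asymptoticSpace (F : ℕ → Ω → Pattern E S) (P : Ω) : Submodule ℝ E :=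
  (isLocalGroup_asymptoticPeriods F P).limitSpace

theorem IsLocalSequence.asymptoticSpace_le_spaceShift (hF : IsLocalSequence F C)
    (hΩ : IsPatternSpace Ω) (z : E) (P : Ω) :
    asymptoticSpace F P ≤ asymptoticSpace F (PatternSpaces.spaceShift hΩ z P) := by
  refine IsLocalGroup.limitSpace_le _ _ fun r => ⟨r + ‖z‖, fun u hu => ?_⟩
  filter_upwards [hu] with n hn x hx
  rw [hF.spaceShift hΩ, hF.spaceShift hΩ, ← hn (x + z) ((norm_add_le _ _).trans (by linarith))]
  exact congrArg (F n P) (by abel)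

theorem IsLocalSequence.asymptoticSpace_spaceShift (hF : IsLocalSequence F C)
    (hΩ : IsPatternSpace Ω) (z : E) (P : Ω) :
    asymptoticSpace F (PatternSpaces.spaceShift hΩ z P) = asymptoticSpace F P := by
  refine le_antisymm ?_ (hF.asymptoticSpace_le_spaceShift hΩ z P)
  have := hF.asymptoticSpace_le_spaceShift hΩ (-z) (PatternSpaces.spaceShift hΩ z P)
  rwa [spaceShift_neg] at this

theorem periodSpace_le_spaceShift (hΩ : IsPatternSpace Ω) (z : E) (P : Ω) :
    periodSpace P.1 ≤ periodSpace (spaceShift hΩ z P).1 := by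
  intro v hv t
  have := hv t
  rw [mem_periods_iff] at this ⊢
  intro x
  rw [spaceShift_apply, spaceShift_apply, ← this (x + z)]
  exact congrArg P.1 (by abel)

theorem periodSpace_spaceShift (hΩ : IsPatternSpace Ω) (z : E) (P : Ω) :
    periodSpace (spaceShift hΩ z P).1 = periodSpace P.1 := by
  refine le_antisymm ?_ (periodSpace_le_spaceShift hΩ z P)
  have := periodSpace_le_spaceShift hΩ (-z) (spaceShift hΩ z P)
  rwa [spaceShift_neg] at this

variable [FiniteDimensional ℝ E]

/-- Upper semicontinuity of the asymptotic space. -/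
theorem IsLocalSequence.exists_asymptoticSpace_le (hF : IsLocalSequence F C) (Q : Ω) :
    ∃ R : ℝ, ∀ P : Ω, Near R 1 P.1 Q.1 → asymptoticSpace F P ≤ asymptoticSpace F Q := by
  obtain ⟨R, e, -, he, hRe⟩ := (isLocalGroup_asymptoticPeriods F Q).exists_mem_limitSpace
  refine ⟨R + 2 + C, ?_⟩
  rintro P ⟨a, ha, hPQ⟩ v hv
  have hm : 0 < min e 1 := by positivity
  -- Only short asymptotic periods transfer from `P` to `Q`, so `v` is scaled down first and scaled
  -- back at the end.
  let t := min e 1 / (2 * (‖v‖ + 1))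
  have ht : 0 < t := by positivity
  have htv : ‖t • v‖ < min e 1 := by
    rw [norm_smul, Real.norm_of_nonneg ht.le, div_mul_eq_mul_div, div_lt_iff₀ (by positivity)]
    nlinarith [norm_nonneg v]
  have h1 : t • v ∈ closure (Metric.ball 0 (min e 1) ∩ asymptoticPeriods F P (R + 2)) :=
    Metric.isOpen_ball.inter_closure ⟨by simpa only [mem_ball_zero_iff] using htv, hv t _⟩
  have h2 : t • v ∈ closure (asymptoticPeriods F Q R) := by
    refine closure_mono ?_ h1
    rintro z ⟨hz, hzP⟩
    rw [mem_ball_zero_iff] at hz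
    exact hF.asymptoticPeriods_of_near ha.le hPQ hzP (hz.le.trans (min_le_right _ _))
  have h3 := hRe _ h2 (htv.trans_le (min_le_left _ _))
  have h4 := Submodule.smul_mem _ t⁻¹ h3
  rwa [smul_smul, inv_mul_cancel₀ ht.ne', one_smul] at h4

/-- An asymptotic period `u` close to `v` differs from it by a short element of the closure of a
local group, which lies in the asymptotic space; so `u` lies there too. -/
theorem IsLocalSequence.exists_mem_asymptoticPeriods_near (Q : Ω) {v : E}
    (hv : v ∈ asymptoticSpace F Q) (r : ℝ) {e : ℝ} (he : 0 < e) :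
    ∃ u ∈ asymptoticSpace F Q, u ∈ asymptoticPeriods F Q r ∧ ‖u - v‖ < e := by
  have hG := isLocalGroup_asymptoticPeriods F Q
  obtain ⟨R, e', -, he', hRe⟩ := hG.exists_mem_limitSpace
  obtain ⟨u, hu, hvu⟩ := Metric.mem_closure_iff.1
    (hG.mem_closure_of_mem_limitSpace hv (max r (R + (‖-v‖ + 1)))) (min e e') (by positivity)
  rw [dist_comm, dist_eq_norm] at hvu
  have h1 : -v + u ∈ closure (asymptoticPeriods F Q R) := by
    refine hG.closure.anti ?_ (hG.closure.add_mem (r := max r (R + (‖-v‖ + 1)))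
      (hG.mem_closure_of_mem_limitSpace (neg_mem hv) _) (subset_closure hu) (lt_add_one _))
    have := le_max_right r (R + (‖-v‖ + 1))
    linarith
  have h2 : -v + u ∈ asymptoticSpace F Q := hRe _ h1 (by
    rw [neg_add_eq_sub]
    exact hvu.trans_le (min_le_right _ _))
  refine ⟨u, ?_, hG.anti (le_max_left _ _) hu, hvu.trans_le (min_le_left _ _)⟩
  have := add_mem hv h2
  rwa [add_neg_cancel_left] at this

/-- Among the patterns with asymptotic space of maximal dimension that is not a space of periods,
the density of the asymptotic periods is uniform. -/
theorem IsLocalSequence.exists_uniform_dense (hF : IsLocalSequence F C)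
    [CompactSpace Ω] {d : ℕ}
    (hd : ∀ P : Ω, ¬ asymptoticSpace F P ≤ periodSpace P.1 →
      Module.finrank ℝ (asymptoticSpace F P) ≤ d) (r : ℝ) :
    ∃ n₀ : ℕ, ∀ n ≥ n₀, ∀ P : Ω, ¬ asymptoticSpace F P ≤ periodSpace P.1 →
      Module.finrank ℝ (asymptoticSpace F P) = d →
      ∀ v ∈ asymptoticSpace F P, ‖v‖ ≤ 1 → ∃ u ∈ asymptoticSpace F P, ‖u - v‖ ≤ 1 / 4 ∧
        ∀ x : E, ‖x‖ ≤ r → F n P (x + u) = F n P x := by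
  have : ProperSpace E := FiniteDimensional.proper ℝ E
  by_contra! hcon
  choose n hn p hpD hpd v hv hv1 hbad using hcon
  obtain ⟨Q, hQ⟩ := exists_eventually_near (Filter.hyperfilter ℕ) p
  obtain ⟨R, hR⟩ := hF.exists_asymptoticSpace_le Q
  have transfer : ∀ (k : ℕ) (a u : E), ‖a‖ ≤ 1 → u ∈ asymptoticSpace F (p k) →
      ‖u - v k‖ ≤ 1 / 4 → (∀ x : E, ‖x‖ ≤ r + 3 + C → (p k).1 x = Q.1 (x + a)) →
      (∀ x : E, ‖x‖ ≤ r + 1 → F (n k) Q (x + u) = F (n k) Q x) → False := by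
    intro k a u ha hu huv hpQ huQ
    obtain ⟨x, hx, hne⟩ := hbad k u hu huv
    have hu2 : ‖u‖ ≤ 2 := by
      have := norm_add_le (u - v k) (v k)
      rw [sub_add_cancel] at this
      linarith [hv1 k]
    refine hne ?_
    rw [hF.eq_add hpQ _ x (by linarith),
      hF.eq_add hpQ _ (x + u) (by linarith [norm_add_le x u]),
      ← huQ (x + a) ((norm_add_le _ _).trans (by linarith))]
    exact congrArg (F (n k) Q) (by abel)
  -- If the asymptotic space of `Q` consists of periods, semicontinuity makes `v k` itself a period
  -- of `Q`. Otherwise maximality of `d` turns the semicontinuity into equality, and one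
  -- approximation to the limit of the `v k` serves all late `k`.
  by_cases hQD : asymptoticSpace F Q ≤ periodSpace Q.1
  · obtain ⟨k, h1, a, ha, hpQ⟩ := ((hQ R 1 one_pos).and (hQ (r + 3 + C) 1 one_pos)).exists
    refine transfer k a (v k) ha.le (hv k) (by simp) hpQ fun x _ => ?_
    exact hF.add_of_mem_periods (mem_periods_of_mem_periodSpace (hQD (hR _ h1 (hv k)))) _ _
  · obtain ⟨v', -, hv'⟩ := (isCompact_closedBall (0 : E) 1).ultrafilter_le_nhds
      ((Filter.hyperfilter ℕ).map v) (by
        rw [Filter.le_principal_iff]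
        exact Filter.mem_map.2 (Filter.univ_mem' fun k => by simpa using hv1 k))
    have hv' : Filter.Tendsto v (Filter.hyperfilter ℕ : Filter ℕ) (𝓝 v') := hv'
    have heq : ∀ k, Near R 1 (p k).1 Q.1 → asymptoticSpace F (p k) = asymptoticSpace F Q :=
      fun k hk => Submodule.eq_of_le_of_finrank_le (hR _ hk) ((hd Q hQD).trans (hpd k).ge)
    have hv'V : v' ∈ asymptoticSpace F Q := by
      have hc : IsClosed (asymptoticSpace F Q : Set E) := Submodule.closed_of_finiteDimensional _
      refine hc.mem_of_tendsto hv' ?_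
      filter_upwards [hQ R 1 one_pos] with k hk
      exact heq k hk ▸ hv k
    obtain ⟨u, hu, huQ, huv'⟩ := exists_mem_asymptoticPeriods_near Q hv'V (r + 1)
      (show (0 : ℝ) < 1 / 8 by norm_num)
    obtain ⟨N, hN⟩ := Filter.eventually_atTop.1 huQ
    obtain ⟨k, h1, ⟨a, ha, hpQ⟩, hvk, hkN⟩ := ((hQ R 1 one_pos).and
      ((hQ (r + 3 + C) 1 one_pos).and ((Metric.tendsto_nhds.1 hv' (1 / 8) (by norm_num)).and
      (eventually_hyperfilter_ge N)))).exists
    have hkN : N ≤ k := by exact_mod_cast hkN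
    refine transfer k a u ha.le (heq k h1 ▸ hu) ?_ hpQ (hN (n k) (hkN.trans (hn k)))
    rw [dist_comm, dist_eq_norm] at hvk
    have := norm_add_le (u - v') (v' - v k)
    rw [sub_add_sub_cancel] at this
    linarith

end LocalSequences

/-! ### Rescaled iterates of the substitution -/

section Substitutions

variable {E : Type u} [NormedAddCommGroup E] [NormedSpace ℝ E] [FiniteDimensional ℝ E]

/-- The inverse of a linear automorphism, as a continuous linear map. -/
noncomputable def inverseCLM (L : E ≃ₗ[ℝ] E) : E →L[ℝ] E := (L.symm : E →ₗ[ℝ] E).toContinuousLinearMap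

theorem inverseCLM_apply (L : E ≃ₗ[ℝ] E) (x : E) : inverseCLM L x = L.symm x := rfl

theorem pow_inverseCLM_apply (L : E ≃ₗ[ℝ] E) (n : ℕ) (x : E) :
    (L ^ n) ((inverseCLM L ^ n) x) = x := by
  induction n with
  | zero => rfl
  | succ n ih =>
    rw [pow_succ L, pow_succ' (inverseCLM L)]
    change (L ^ n) (L (L.symm ((inverseCLM L ^ n) x))) = x
    rw [LinearEquiv.apply_symm_apply, ih]

theorem inverseCLM_pow_apply (L : E ≃ₗ[ℝ] E) (n : ℕ) (x : E) :
    (inverseCLM L ^ n) ((L ^ n) x) = x :=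
  (L ^ n).injective (pow_inverseCLM_apply L n _)

theorem IsExpansive.summable {L : E ≃ₗ[ℝ] E} (hL : IsExpansive L) :
    Summable fun n : ℕ => ‖inverseCLM L ^ n‖ := by
  refine summable_norm_pow_of_hasEigenvalue _ fun μ hμ => ?_
  obtain ⟨v, hv⟩ := hμ.exists_hasEigenvector
  have h1 : (L.symm : E →ₗ[ℝ] E).baseChange ℂ v = μ • v := hv.apply_eq_smul
  have h2 : (L : E →ₗ[ℝ] E).baseChange ℂ ((L.symm : E →ₗ[ℝ] E).baseChange ℂ v) = v := by
    rw [← LinearMap.comp_apply, ← LinearMap.baseChange_comp]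
    simp
  rw [h1, map_smul] at h2
  have hμ0 : μ ≠ 0 := by
    rintro rfl
    rw [zero_smul] at h2
    exact hv.2 h2.symm
  have h3 : (L : E →ₗ[ℝ] E).baseChange ℂ v = μ⁻¹ • v := by
    rw [← h2, smul_smul, inv_mul_cancel₀ hμ0, one_smul, h2]
  have h4 := hL μ⁻¹ (Module.End.hasEigenvalue_of_hasEigenvector
    ⟨Module.End.mem_eigenspace_iff.2 h3, hv.2⟩)
  rw [norm_inv] at h4
  exact (one_lt_inv_iff₀.1 h4).2

theorem IsExpansive.eventually_norm_lt {L : E ≃ₗ[ℝ] E} (hL : IsExpansive L) (R : ℝ) {e : ℝ}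
    (he : 0 < e) : ∀ᶠ n : ℕ in Filter.atTop, ∀ x : E, ‖x‖ ≤ R → ‖(inverseCLM L ^ n) x‖ < e := by
  have h1 := (hL.summable.tendsto_atTop_zero.mul_const (max R 0))
  rw [zero_mul] at h1
  filter_upwards [h1.eventually (gt_mem_nhds he)] with n hn x hx
  refine lt_of_le_of_lt (((inverseCLM L ^ n).le_opNorm x).trans ?_) hn
  gcongr
  exact hx.trans (le_max_left _ _)

variable {S : Type v} {Ω : Set (Pattern E S)} {L : E ≃ₗ[ℝ] E}

omit [FiniteDimensional ℝ E] in
theorem LSub.exists_local (s : LSub L Ω) : ∃ c : ℝ, 0 ≤ c ∧ ∀ (P Q : Ω) (x y : E),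
    (∀ t : E, ‖t‖ ≤ c → P.1 (L.symm (x + t)) = Q.1 (L.symm (y + t))) →
      (s.substitution P).1 x = (s.substitution Q).1 y := by
  obtain ⟨c, hc, h⟩ := s.isLDMap
  refine ⟨c, hc, fun P Q x y hPQ => h _ _ x y (patch_eq_iff.2 fun t ht => ?_)⟩
  exact hPQ t (by simpa using ht)

/-- The iterates of the substitution, scaled back to the size of the original pattern. -/
def LSub.rescaled (s : LSub L Ω) (n : ℕ) (P : Ω) : Pattern E S :=
  fun x => (s.substitution^[n] P).1 ((L ^ n) x)

omit [FiniteDimensional ℝ E] in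
theorem LSub.rescaled_apply (s : LSub L Ω) (n : ℕ) (P : Ω) (x : E) :
    s.rescaled n P x = (s.substitution^[n] P).1 ((L ^ n) x) := rfl

theorem LSub.iterate_apply (s : LSub L Ω) (n : ℕ) (P : Ω) (x : E) :
    (s.substitution^[n] P).1 x = s.rescaled n P ((inverseCLM L ^ n) x) := by
  rw [rescaled_apply, pow_inverseCLM_apply]

omit [FiniteDimensional ℝ E] in
theorem LSub.rescaled_add (s : LSub L Ω) (n m : ℕ) (P : Ω) (x : E) :
    s.rescaled (n + m) P x = s.rescaled n (s.substitution^[m] P) ((L ^ m) x) := by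
  rw [rescaled_apply, rescaled_apply, Function.iterate_add_apply, pow_add]
  rfl

/-- In rescaled coordinates, the passage from level `n` to level `n + 1` looks only as far as
`‖L⁻⁽ⁿ⁺¹⁾‖ * c`, and these radii have a finite sum. -/
theorem LSub.exists_isLocalSequence (s : LSub L Ω) (hL : IsExpansive L) :
    ∃ C : ℝ, 0 ≤ C ∧ IsLocalSequence s.rescaled C := by
  obtain ⟨c, hc, h⟩ := s.exists_local
  have hsum : Summable fun n : ℕ => ‖inverseCLM L ^ (n + 1)‖ * c :=
    ((summable_nat_add_iff 1).2 hL.summable).mul_right c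
  have hnn : ∀ n : ℕ, 0 ≤ ‖inverseCLM L ^ (n + 1)‖ * c := fun n => by positivity
  have step : ∀ (n : ℕ) (P Q : Ω) (x y : E),
      (∀ t : E, ‖t‖ ≤ ‖inverseCLM L ^ (n + 1)‖ * c →
        s.rescaled n P (x + t) = s.rescaled n Q (y + t)) →
      s.rescaled (n + 1) P x = s.rescaled (n + 1) Q y := by
    intro n P Q x y hPQ
    rw [rescaled_apply, rescaled_apply, Function.iterate_succ_apply', Function.iterate_succ_apply']
    refine h _ _ _ _ fun t ht => ?_
    have h1 : ∀ z : E, L.symm ((L ^ (n + 1)) z + t) =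
        (L ^ n) (z + (inverseCLM L ^ (n + 1)) t) := by
      intro z
      apply L.injective
      rw [LinearEquiv.apply_symm_apply]
      nth_rewrite 1 [← pow_inverseCLM_apply L (n + 1) t]
      rw [← map_add]
      rw [pow_succ' L]
      rfl
    rw [h1, h1]
    exact hPQ _ (((inverseCLM L ^ (n + 1)).le_opNorm t).trans (by gcongr))
  refine ⟨∑' n : ℕ, ‖inverseCLM L ^ (n + 1)‖ * c, tsum_nonneg hnn, ?_⟩
  have key : ∀ (n : ℕ) (P Q : Ω) (x y : E),
      (∀ t : E, ‖t‖ ≤ ∑ k ∈ Finset.range n, ‖inverseCLM L ^ (k + 1)‖ * c →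
        P.1 (x + t) = Q.1 (y + t)) → s.rescaled n P x = s.rescaled n Q y := by
    intro n
    induction n with
    | zero =>
      intro P Q x y hPQ
      have := hPQ 0 (by simp)
      rwa [add_zero, add_zero] at this
    | succ n ih =>
      intro P Q x y hPQ
      refine step n P Q x y fun t ht => ih P Q _ _ fun t' ht' => ?_
      rw [add_assoc, add_assoc]
      refine hPQ _ ((norm_add_le _ _).trans ?_)
      rw [Finset.sum_range_succ]
      linarith
  exact fun n P Q x y hPQ => key n P Q x y fun t ht =>
    hPQ t (ht.trans (hsum.sum_le_tsum _ fun k _ => hnn k))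

omit [FiniteDimensional ℝ E] in
theorem LSub.substitution_surjective (s : LSub L Ω) : Function.Surjective s.substitution := by
  intro P
  obtain ⟨⟨_, Q, hQ, rfl⟩, h⟩ := s.surjective P
  exact ⟨⟨Q, hQ⟩, h⟩

variable {C : ℝ}

theorem LSub.iterate_spaceShift {s : LSub L Ω} (hF : IsLocalSequence s.rescaled C)
    (hΩ : IsPatternSpace Ω) (n : ℕ) (z : E) (P : Ω) :
    s.substitution^[n] (spaceShift hΩ z P) =
      spaceShift hΩ ((L ^ n) z) (s.substitution^[n] P) := by
  refine Subtype.ext (funext fun x => ?_)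
  rw [spaceShift_apply, s.iterate_apply, s.iterate_apply, hF.spaceShift hΩ, map_add,
    inverseCLM_pow_apply]

omit [NormedSpace ℝ E] [FiniteDimensional ℝ E] in
theorem mem_periods_iff_spaceShift (hΩ : IsPatternSpace Ω) {P : Ω} {z : E} :
    z ∈ periods P.1 ↔ spaceShift hΩ z P = P := by
  rw [mem_periods_iff]
  exact ⟨fun h => Subtype.ext (funext h), fun h x => congrFun (congrArg Subtype.val h) x⟩

theorem LSub.mem_periods_iterate {s : LSub L Ω} (hF : IsLocalSequence s.rescaled C)
    (hΩ : IsPatternSpace Ω) (n : ℕ) {z : E} {P : Ω} (hz : z ∈ periods P.1) :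
    (L ^ n) z ∈ periods (s.substitution^[n] P).1 := by
  rw [mem_periods_iff_spaceShift hΩ] at hz ⊢
  rw [← iterate_spaceShift hF, hz]

theorem LSub.mem_periods_of_iterate {s : LSub L Ω} (hF : IsLocalSequence s.rescaled C)
    (hΩ : IsPatternSpace Ω) (hs : Function.Injective s.substitution) {n : ℕ} {z : E} {P : Ω}
    (hz : (L ^ n) z ∈ periods (s.substitution^[n] P).1) : z ∈ periods P.1 := by
  rw [mem_periods_iff_spaceShift hΩ] at hz ⊢
  rw [← iterate_spaceShift hF] at hz
  exact hs.iterate n hz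

/-- Desubstituting often enough makes any period short enough for the uniform bound on `Ω`;
substituting again carries the resulting line of periods back. -/
theorem LSub.mem_periodSpace_of_injective (s : LSub L Ω) (hL : IsExpansive L)
    (hΩ : IsPatternSpace Ω) [CompactSpace Ω] [T2Space Ω]
    (hs : Function.Injective s.substitution) {P : Pattern E S} (hP : P ∈ Ω) {z : E}
    (hz : z ∈ periods P) : z ∈ periodSpace P := by
  obtain ⟨C, -, hF⟩ := s.exists_isLocalSequence hL
  obtain ⟨e, he, h⟩ := exists_pos_forall_mem_periodSpace hΩ
  obtain ⟨n, hn⟩ := (hL.eventually_norm_lt ‖z‖ he).exists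
  obtain ⟨Q, hQ⟩ := s.substitution_surjective.iterate n ⟨P, hP⟩
  have hzQ : (inverseCLM L ^ n) z ∈ periods Q.1 := by
    refine mem_periods_of_iterate hF hΩ hs (n := n) ?_
    rwa [pow_inverseCLM_apply, hQ]
  intro t
  have h1 := mem_periods_iterate hF hΩ n (h Q.1 Q.2 _ hzQ (hn z le_rfl) t)
  rwa [map_smul, pow_inverseCLM_apply, hQ] at h1

theorem eventually_add_iff {p : ℕ → Prop} (m : ℕ) :
    (∀ᶠ n in Filter.atTop, p (n + m)) ↔ ∀ᶠ n in Filter.atTop, p n := by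
  conv_rhs => rw [← Filter.map_add_atTop_eq_nat m]
  rfl

omit [FiniteDimensional ℝ E] in
theorem IsLocalGroup.map_mem_limitSpace {G G' : ℝ → Set E} (h : IsLocalGroup G)
    (h' : IsLocalGroup G') (T : E →L[ℝ] E) (hG : ∀ r, ∃ r', MapsTo T (G r') (G' r)) {v : E}
    (hv : v ∈ h.limitSpace) : T v ∈ h'.limitSpace := by
  intro t r
  obtain ⟨r', hr'⟩ := hG r
  rw [← map_smul]
  exact map_mem_closure T.continuous (hv t r') hr'

/-- The sequence of `σᵐ P`, composed with `Lᵐ`, is the sequence of `P` with its index shifted by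
`m`. -/
theorem LSub.mem_asymptoticSpace_iterate (s : LSub L Ω) (m : ℕ) (P : Ω) (v : E) :
    (L ^ m) v ∈ asymptoticSpace s.rescaled (s.substitution^[m] P) ↔
      v ∈ asymptoticSpace s.rescaled P := by
  let T : E →L[ℝ] E := ((L ^ m : E ≃ₗ[ℝ] E) : E →ₗ[ℝ] E).toContinuousLinearMap
  constructor
  · intro hv
    have h1 := (isLocalGroup_asymptoticPeriods s.rescaled (s.substitution^[m] P)).map_mem_limitSpace
      (isLocalGroup_asymptoticPeriods s.rescaled P) (inverseCLM L ^ m)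
      (fun r => ⟨‖T‖ * max r 0, fun z hz => ?_⟩) hv
    · rwa [inverseCLM_pow_apply] at h1
    · refine (eventually_add_iff m).1 ?_
      filter_upwards [hz] with n hn x hx
      rw [s.rescaled_add, s.rescaled_add, map_add, pow_inverseCLM_apply]
      refine hn _ ((T.le_opNorm x).trans ?_)
      gcongr
      exact hx.trans (le_max_left _ _)
  · refine (isLocalGroup_asymptoticPeriods s.rescaled P).map_mem_limitSpace
      (isLocalGroup_asymptoticPeriods s.rescaled (s.substitution^[m] P)) T
      fun r => ⟨‖inverseCLM L ^ m‖ * max r 0, fun z hz => ?_⟩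
    filter_upwards [(eventually_add_iff m).2 hz] with n hn x hx
    have h1 := hn ((inverseCLM L ^ m) x) (((inverseCLM L ^ m).le_opNorm x).trans (by
      gcongr
      exact hx.trans (le_max_left _ _)))
    rw [s.rescaled_add, s.rescaled_add, map_add, pow_inverseCLM_apply] at h1
    exact h1

end Substitutions

/-! ### Injectivity of the substitution and its local inverse -/

section Recognizability

variable {E : Type u} [NormedAddCommGroup E] [NormedSpace ℝ E] [FiniteDimensional ℝ E] {S : Type v}
  {Ω : Set (Pattern E S)} {L : E ≃ₗ[ℝ] E}

omit [NormedSpace ℝ E] [FiniteDimensional ℝ E] in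
theorem Near.shift_apply {R : ℝ} {P Q : Pattern E S} {y z : E} {T : Pattern E S}
    (h : Near (R + 2) 1 (shift y P) T) (h' : Near (R + 2) 1 (shift z Q) T) :
    ∃ y' : E, ‖y'‖ ≤ ‖y‖ + 2 ∧ ∀ t : E, ‖t‖ ≤ R → Q (z + t) = P (y' + t) := by
  obtain ⟨a, ha, hP⟩ := h
  obtain ⟨b, hb, hQ⟩ := h'
  refine ⟨y + (b - a), (norm_add_le _ _).trans (by linarith [norm_sub_le b a]), fun t ht => ?_⟩
  have h1 : Q (t + z) = T (t + b) := hQ t (by linarith)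
  have h2 : P (t + (b - a) + y) = T (t + (b - a) + a) :=
    hP _ ((norm_add_le _ _).trans (by linarith [norm_sub_le b a]))
  rw [add_comm z, h1, show y + (b - a) + t = t + (b - a) + y by abel, h2]
  exact congrArg T (by abel)

/-- Every patch of given radius of a pattern in a compact pattern space occurs in a bounded part of
that pattern. -/
theorem exists_bounded_occurrence (hΩ : IsPatternSpace Ω) [CompactSpace Ω] (P : Ω) (R : ℝ) :
    ∃ T : ℝ, ∀ y : E, ∃ y' : E, ‖y'‖ ≤ T ∧ ∀ t : E, ‖t‖ ≤ R → P.1 (y + t) = P.1 (y' + t) := by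
  by_contra! hcon
  choose y hy using fun n : ℕ => hcon n
  obtain ⟨Q, hQ⟩ := exists_eventually_near (Filter.hyperfilter ℕ)
    fun n => spaceShift hΩ (y n) P
  have h := hQ (R + 2) 1 one_pos
  obtain ⟨m, hm⟩ := h.exists
  -- The patch at `y n` repeats one within distance 2 of `y m`, hence within `n` of the origin.
  obtain ⟨n, hn, hmn⟩ := (h.and (eventually_hyperfilter_ge (‖y m‖ + 2))).exists
  obtain ⟨y', hy', hyt⟩ := Near.shift_apply hm hn
  obtain ⟨t, ht, hne⟩ := hy n y' (hy'.trans hmn)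
  exact hne (hyt t ht)

/-- The pattern `x ↦ P[L ^ n x]`. -/
def dilate (L : E ≃ₗ[ℝ] E) (n : ℕ) (P : Pattern E S) : Pattern E S := fun x => P ((L ^ n) x)

theorem exists_bounded_occurrence_dilate (hΩ : IsPatternSpace Ω) [CompactSpace Ω] (P : Ω) (n : ℕ)
    (R : ℝ) : ∃ T : ℝ, ∀ y : E, ∃ y' : E, ‖y'‖ ≤ T ∧
      ∀ t : E, ‖t‖ ≤ R → dilate L n P.1 (y + t) = dilate L n P.1 (y' + t) := by
  let M : E →L[ℝ] E := ((L ^ n : E ≃ₗ[ℝ] E) : E →ₗ[ℝ] E).toContinuousLinearMap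
  obtain ⟨T, hT⟩ := exists_bounded_occurrence hΩ P (‖M‖ * max R 0)
  refine ⟨‖inverseCLM L ^ n‖ * T, fun y => ?_⟩
  obtain ⟨y', hy', h⟩ := hT ((L ^ n) y)
  refine ⟨(inverseCLM L ^ n) y', ((inverseCLM L ^ n).le_opNorm y').trans (by gcongr),
    fun t ht => ?_⟩
  change P.1 ((L ^ n) (y + t)) = P.1 ((L ^ n) ((inverseCLM L ^ n) y' + t))
  rw [map_add, map_add, pow_inverseCLM_apply]
  refine h _ ((M.le_opNorm t).trans ?_)
  gcongr
  exact ht.trans (le_max_left _ _)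

variable {C : ℝ}

/-- If the groups of periods are all connected, then the asymptotic periods of any element of `Ω`
are periods. -/
theorem LSub.asymptoticSpace_le_periodSpace (s : LSub L Ω) (hL : IsExpansive L)
    (hΩ : IsPatternSpace Ω) [CompactSpace Ω] (hF : IsLocalSequence s.rescaled C)
    (hper : ∀ P ∈ Ω, ∀ z ∈ periods P, z ∈ periodSpace P) (P : Ω) :
    asymptoticSpace s.rescaled P ≤ periodSpace P.1 := by
  by_contra hP₀
  obtain ⟨P, hP, hmax⟩ : ∃ P : Ω, ¬ asymptoticSpace s.rescaled P ≤ periodSpace P.1 ∧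
      ∀ Q : Ω, ¬ asymptoticSpace s.rescaled Q ≤ periodSpace Q.1 →
        Module.finrank ℝ (asymptoticSpace s.rescaled Q) ≤
          Module.finrank ℝ (asymptoticSpace s.rescaled P) := by
    let A : Set ℕ := {d | ∃ P : Ω, ¬ asymptoticSpace s.rescaled P ≤ periodSpace P.1 ∧
      Module.finrank ℝ (asymptoticSpace s.rescaled P) = d}
    have hA : A.Nonempty := ⟨_, P, hP₀, rfl⟩
    have hAb : BddAbove A := ⟨Module.finrank ℝ E, by
      rintro _ ⟨Q, -, rfl⟩
      exact Submodule.finrank_le _⟩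
    obtain ⟨P, hP, hd⟩ := Nat.sSup_mem hA hAb
    exact ⟨P, hP, fun Q hQ => hd ▸ le_csSup hAb ⟨Q, hQ, rfl⟩⟩
  obtain ⟨n₀, hn₀⟩ := hF.exists_uniform_dense hmax 10
  let V : ℕ → Submodule ℝ E := fun n =>
    (asymptoticSpace s.rescaled P).comap ((L ^ n : E ≃ₗ[ℝ] E) : E →ₗ[ℝ] E)
  have hV : ∀ n v, v ∈ V n ↔ (L ^ n) v ∈ asymptoticSpace s.rescaled P := fun n v => Iff.rfl
  -- With `P = σⁿ Q`, the dilated pattern is `s.rescaled n Q`. Every translate of `Q` is again a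
  -- counterexample of the same dimension, so the uniform density holds about every centre.
  have hdense : ∀ n ≥ n₀, HasDensePeriods (dilate L n P.1) (V n) := by
    intro n hn y v hv hv1
    obtain ⟨Q, hQ⟩ := s.substitution_surjective.iterate n P
    have hVQ : asymptoticSpace s.rescaled Q = V n := by
      ext v
      rw [hV, ← hQ, s.mem_asymptoticSpace_iterate]
    have hQP : ∀ x, dilate L n P.1 x = s.rescaled n Q x := fun x => by
      rw [s.rescaled_apply, hQ]
      rfl
    have hQbad : ¬ asymptoticSpace s.rescaled Q ≤ periodSpace Q.1 := by
      intro hle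
      refine hP fun w hw t => ?_
      have h1 : (inverseCLM L ^ n) w ∈ asymptoticSpace s.rescaled Q := by
        rw [hVQ, hV, pow_inverseCLM_apply]
        exact hw
      have h2 := mem_periods_iterate hF hΩ n (hle h1 t)
      rwa [map_smul, pow_inverseCLM_apply, hQ] at h2
    have hrank : Module.finrank ℝ (asymptoticSpace s.rescaled Q) =
        Module.finrank ℝ (asymptoticSpace s.rescaled P) := by
      rw [hVQ]
      refine le_antisymm (hVQ ▸ hmax Q hQbad) ?_
      have h3 : (asymptoticSpace s.rescaled P).comap ((L ^ n : E ≃ₗ[ℝ] E) : E →ₗ[ℝ] E) =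
          (asymptoticSpace s.rescaled P).map ((L ^ n).symm : E →ₗ[ℝ] E) :=
        Submodule.comap_equiv_eq_map_symm _ _
      change _ ≤ Module.finrank ℝ
        ((asymptoticSpace s.rescaled P).comap ((L ^ n : E ≃ₗ[ℝ] E) : E →ₗ[ℝ] E))
      rw [h3]
      exact (LinearEquiv.finrank_map_eq (L ^ n).symm _).ge
    have hVy := hF.asymptoticSpace_spaceShift hΩ y Q
    obtain ⟨u, hu, huv, hux⟩ := hn₀ n hn (spaceShift hΩ y Q)
      (by rwa [hVy, periodSpace_spaceShift]) (by rwa [hVy]) v (by rwa [hVy, hVQ]) hv1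
    refine ⟨u, by rwa [hVy, hVQ] at hu, huv, fun x hx => ?_⟩
    have h4 := hux x hx
    rw [hF.spaceShift hΩ, hF.spaceShift hΩ] at h4
    rw [hQP, hQP, add_comm y, ← h4]
    exact congrArg _ (by abel)
  obtain ⟨T, hT⟩ := exists_bounded_occurrence_dilate (L := L) hΩ P n₀ 4
  -- With this `m`, a strip of radius 1 at level `n₀ + m` covers, after applying `L ^ m`, the strip
  -- of radius `T + 1` at level `n₀` that determines global periods.
  obtain ⟨m, hm⟩ := (hL.eventually_norm_lt (T + 1) one_pos).exists
  have hadd : ∀ x, (L ^ (n₀ + m)) x = (L ^ n₀) ((L ^ m) x) := fun x => by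
    rw [pow_add]
    rfl
  have hle : V (n₀ + m) ≤
      (periodSpace P.1).comap ((L ^ (n₀ + m) : E ≃ₗ[ℝ] E) : E →ₗ[ℝ] E) := by
    refine le_of_dense fun v hv hv1 => ?_
    obtain ⟨u, hu, huv⟩ := (hdense (n₀ + m) (Nat.le_add_right _ _)).exists_mem_stripPeriods 0 hv hv1
    refine ⟨u, hu.1, ?_, huv⟩
    have huP : (L ^ m) u ∈ periods (dilate L n₀ P.1) := by
      refine (hdense n₀ le_rfl).mem_periods hT ?_ fun w hw x hx => ?_
      · rw [hV, ← hadd]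
        exact hu.1
      · have h1 := hu.2 ((inverseCLM L ^ m) w) (by
          rw [hV, hadd, pow_inverseCLM_apply]
          exact hw) ((inverseCLM L ^ m) x) (hm x hx).le
        change P.1 ((L ^ (n₀ + m)) _) = P.1 ((L ^ (n₀ + m)) _) at h1
        rw [hadd, hadd, zero_add, map_add (L ^ m), map_add (L ^ m), pow_inverseCLM_apply,
          pow_inverseCLM_apply] at h1
        exact h1
    -- This is where connectedness enters: the period found for `P` generates a line of periods, so
    -- density suffices to capture all of `V (n₀ + m)`.
    refine hper P.1 P.2 _ ?_
    rw [mem_periods_iff] at huP ⊢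
    intro x
    have h2 : P.1 ((L ^ n₀) ((inverseCLM L ^ n₀) x + (L ^ m) u)) =
      P.1 ((L ^ n₀) ((inverseCLM L ^ n₀) x)) := huP _
    rw [map_add, pow_inverseCLM_apply, ← hadd] at h2
    exact h2
  refine hP fun v hv => ?_
  have h1 : (inverseCLM L ^ (n₀ + m)) v ∈ V (n₀ + m) := by
    rw [hV, pow_inverseCLM_apply]
    exact hv
  have h2 : (L ^ (n₀ + m)) ((inverseCLM L ^ (n₀ + m)) v) ∈ periodSpace P.1 := hle h1
  rwa [pow_inverseCLM_apply] at h2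

theorem LSub.injective_of_periods (s : LSub L Ω) (hL : IsExpansive L)
    (hΩ : IsPatternSpace Ω) [CompactSpace Ω]
    (hper : ∀ P ∈ Ω, ∀ z ∈ periods P, z ∈ periodSpace P) :
    Function.Injective s.substitution := by
  obtain ⟨C, -, hF⟩ := s.exists_isLocalSequence hL
  have hV := s.asymptoticSpace_le_periodSpace hL hΩ hF hper
  intro A B hAB
  by_contra hne
  obtain ⟨x₀, hx₀⟩ : ∃ x, A.1 x ≠ B.1 x := by
    by_contra! h
    exact hne (Subtype.ext (funext h))
  choose A' hA' using fun k => s.substitution_surjective.iterate k A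
  choose B' hB' using fun k => s.substitution_surjective.iterate k B
  let p : ℕ → Ω := fun k => spaceShift hΩ ((inverseCLM L ^ k) x₀) (A' k)
  let q : ℕ → Ω := fun k => spaceShift hΩ ((inverseCLM L ^ k) x₀) (B' k)
  have hpq : ∀ k, s.rescaled k (p k) 0 ≠ s.rescaled k (q k) 0 := by
    intro k
    rw [hF.spaceShift hΩ, hF.spaceShift hΩ, zero_add, ← s.iterate_apply, ← s.iterate_apply, hA',
      hB']
    exact hx₀
  -- After `k` substitutions the pair is a translate of `(A, B)`; one more substitution makes the
  -- two patterns equal.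
  have hmerge : ∀ k m, k < m → ∀ x, s.rescaled m (p k) x = s.rescaled m (q k) x := by
    intro k m hkm x
    obtain ⟨j, rfl⟩ := Nat.exists_eq_add_of_lt hkm
    rw [hF.spaceShift hΩ, hF.spaceShift hΩ, show k + j + 1 = (j + 1) + k by ring,
      s.rescaled_add (j + 1), s.rescaled_add (j + 1), hA', hB', s.rescaled_add j 1,
      s.rescaled_add j 1, Function.iterate_one, hAB]
  obtain ⟨P, hP⟩ := exists_eventually_near (Filter.hyperfilter ℕ) p
  obtain ⟨Q, hQ⟩ := exists_eventually_near (Filter.hyperfilter ℕ) q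
  obtain ⟨R, e, hR, he, hRe⟩ :=
    (isLocalGroup_asymptoticPeriods s.rescaled Q).exists_mem_limitSpace
  let δ := min (e / 4) 1
  have hδ : 0 < δ := by positivity
  have hδe : δ ≤ e / 4 := min_le_left _ _
  have hδ1 : δ ≤ 1 := min_le_right _ _
  have hgood := (hP (R + 5 + C) δ hδ).and (hQ (R + 5 + C) δ hδ)
  obtain ⟨k, ⟨a, ha, hPa⟩, ⟨b, hb, hQb⟩⟩ := hgood.exists
  obtain ⟨l, ⟨⟨a', ha', hPa'⟩, ⟨b', hb', hQb'⟩⟩, hkl⟩ :=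
    (hgood.and (eventually_hyperfilter_ge (k + 1))).exists
  have hkl : k < l := by exact_mod_cast hkl
  have conj : ∀ (i m : ℕ) (a b y : E), i < m → ‖a‖ < δ →
      (∀ x : E, ‖x‖ ≤ R + 5 + C → (p i).1 x = P.1 (x + a)) →
      (∀ x : E, ‖x‖ ≤ R + 5 + C → (q i).1 x = Q.1 (x + b)) → ‖y‖ ≤ R + 3 →
      s.rescaled m P y = s.rescaled m Q (y + (b - a)) := by
    intro i m a b y him ha hPa hQb hy
    have hya : ‖y - a‖ ≤ R + 4 := (norm_sub_le _ _).trans (by linarith)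
    have h1 := hF.eq_add hPa m (y - a) (by linarith)
    have h2 := hF.eq_add hQb m (y - a) (by linarith)
    rw [sub_add_cancel] at h1
    rw [← h1, hmerge i m him, h2]
    exact congrArg _ (by abel)
  -- For `m > l`, both `b - a` and `b' - a'` translate level `m` of `P` to level `m` of `Q` locally.
  have hz : b - a - (b' - a') ∈ asymptoticPeriods s.rescaled Q R := by
    filter_upwards [Filter.eventually_gt_atTop l] with m hm x hx
    have hy : ‖x - (b' - a')‖ ≤ R + 3 :=
      (norm_sub_le _ _).trans (by linarith [norm_sub_le b' a'])
    have h1 := conj k m a b (x - (b' - a')) (hkl.trans hm) ha hPa hQb hy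
    have h2 := conj l m a' b' (x - (b' - a')) hm ha' hPa' hQb' hy
    rw [sub_add_cancel] at h2
    rw [← h2, h1]
    exact congrArg _ (by abel)
  have hzQ : b - a - (b' - a') ∈ periods Q.1 := by
    refine mem_periods_of_mem_periodSpace (hV Q (hRe _ (subset_closure hz) ?_))
    have h1 := norm_sub_le (b - a) (b' - a')
    linarith [norm_sub_le b a, norm_sub_le b' a']
  -- At level `l` the pair of index `l` still differs at 0, but the conjugacy by `b - a` from index
  -- `k < l` already holds. The period of `Q` converts it into the missing conjugacy by `b' - a'`.
  refine hpq l ?_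
  have h1 := hF.eq_add hPa' l 0 (by rw [norm_zero]; linarith)
  have h2 := hF.eq_add hQb' l 0 (by rw [norm_zero]; linarith)
  rw [h1, h2, zero_add, zero_add, conj k l a b a' hkl ha hPa hQb (by linarith),
    ← hF.add_of_mem_periods hzQ l b']
  exact congrArg _ (by abel)

/-- The substitution is uniformly continuous, with control of the translations. -/
theorem LSub.exists_substitution_near (s : LSub L Ω) (hF : IsLocalSequence s.rescaled C) (R : ℝ)
    {e : ℝ} (he : 0 < e) : ∃ R' e' : ℝ, 0 < e' ∧ ∀ (P Q : Ω) (a : E), ‖a‖ < e' →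
      (∀ x : E, ‖x‖ ≤ R' → P.1 x = Q.1 (x + a)) → ‖L a‖ < e ∧
        ∀ x : E, ‖x‖ ≤ R → (s.substitution P).1 x = (s.substitution Q).1 (x + L a) := by
  let M : E →L[ℝ] E := (L : E →ₗ[ℝ] E).toContinuousLinearMap
  refine ⟨‖inverseCLM L‖ * max R 0 + C, e / (‖M‖ + 1), by positivity, fun P Q a ha hPQ => ⟨?_, ?_⟩⟩
  · rw [lt_div_iff₀ (by positivity)] at ha
    have := M.le_opNorm a
    change ‖M a‖ < e
    nlinarith [norm_nonneg a]
  · intro x hx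
    have h1 := hF.eq_add hPQ 1 (inverseCLM L x) (by
      gcongr
      refine ((inverseCLM L).le_opNorm x).trans ?_
      gcongr
      exact hx.trans (le_max_left _ _))
    rw [s.rescaled_apply, s.rescaled_apply, pow_one, map_add, inverseCLM_apply,
      LinearEquiv.apply_symm_apply, Function.iterate_one] at h1
    exact h1

theorem LSub.continuous_substitution (s : LSub L Ω) (hL : IsExpansive L) :
    Continuous s.substitution := by
  obtain ⟨C, -, hF⟩ := s.exists_isLocalSequence hL
  refine UniformContinuous.continuous fun U hU => ?_
  obtain ⟨R, e, he, hU⟩ := mem_uniformity_subtype_iff_near.1 hU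
  obtain ⟨R', e', he', h⟩ := s.exists_substitution_near hF R he
  refine Filter.mem_map.2 (mem_uniformity_subtype_iff_near.2 ⟨R', e', he', ?_⟩)
  rintro P Q ⟨a, ha, hPQ⟩
  obtain ⟨h1, h2⟩ := h P Q a ha hPQ
  exact hU _ _ ⟨L a, h1, h2⟩

/-- An injective substitution is locally invertible, with a uniform radius. -/
theorem LSub.exists_local_inverse (s : LSub L Ω) (hL : IsExpansive L) (hΩ : IsPatternSpace Ω)
    [CompactSpace Ω] [T2Space Ω] (hs : Function.Injective s.substitution) :
    ∃ c : ℝ, 0 ≤ c ∧ ∀ P Q : Ω,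
      (∀ t : E, ‖t‖ ≤ c → (s.substitution P).1 t = (s.substitution Q).1 t) → P.1 0 = Q.1 0 := by
  obtain ⟨C, -, hF⟩ := s.exists_isLocalSequence hL
  by_contra! hcon
  choose p q hpq hne using fun n : ℕ => hcon n n.cast_nonneg
  obtain ⟨P, hP⟩ := exists_eventually_near (Filter.hyperfilter ℕ) p
  obtain ⟨Q, hQ⟩ := exists_eventually_near (Filter.hyperfilter ℕ) q
  -- The images agree on ever larger balls, so the limits have equal images, and injectivity
  -- applies.
  have hPQ : P = Q := by
    refine hs (eq_of_forall_near _ _ fun R e he => ?_)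
    obtain ⟨R', e', he', h⟩ := s.exists_substitution_near hF (R + e) (half_pos he)
    obtain ⟨n, ⟨a, ha, hPa⟩, ⟨b, hb, hQb⟩, hn⟩ := ((hP R' e' he').and
      ((hQ R' e' he').and (eventually_hyperfilter_ge (R + e)))).exists
    obtain ⟨h1, h2⟩ := h _ _ a ha hPa
    obtain ⟨h3, h4⟩ := h _ _ b hb hQb
    have h5 : Near (R + e / 2) (e / 2) (s.substitution P).1 (s.substitution (p n)).1 :=
      Near.mono (Near.symm ⟨L a, h1, h2⟩) (by linarith) le_rfl
    have h6 : Near (R + e / 2) (e / 2) (s.substitution (p n)).1 (s.substitution Q).1 :=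
      ⟨L b, h3, fun x hx => (hpq n x (by linarith)).trans (h4 x (by linarith))⟩
    exact ((h5.mono (by linarith) le_rfl).trans h6).mono le_rfl (by linarith)
  subst hPQ
  obtain ⟨R, e, hR, he, hV⟩ := exists_mem_periodSpace hΩ (s.substitution P)
  obtain ⟨R', e', he', h⟩ := s.exists_substitution_near hF (R + e) (half_pos he)
  obtain ⟨n, ⟨a, ha, hPa⟩, ⟨b, hb, hQb⟩, hn⟩ := ((hP (max R' 0) e' he').and
    ((hQ (max R' 0) e' he').and (eventually_hyperfilter_ge (R + e)))).exists
  obtain ⟨h1, h2⟩ := h _ _ a ha fun x hx => hPa x (hx.trans (le_max_left _ _))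
  obtain ⟨h3, h4⟩ := h _ _ b hb fun x hx => hQb x (hx.trans (le_max_left _ _))
  -- The remaining translation ambiguity is a short local period of the common image, hence a
  -- period, which injectivity pulls back to `P`.
  have hba : L (b - a) ∈ periods (s.substitution P).1 := by
    rw [map_sub]
    refine mem_periods_of_mem_periodSpace (hV _ ((norm_sub_le _ _).trans_lt (by linarith))
      fun x hx => ?_)
    have hxa : ‖x - L a‖ ≤ R + e := (norm_sub_le _ _).trans (by linarith)
    have h5 := h2 _ hxa
    have h6 := h4 _ hxa
    rw [← hpq n _ (hxa.trans hn), h5, sub_add_cancel] at h6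
    rw [h6]
    exact congrArg _ (by abel)
  have hba' : b - a ∈ periods P.1 := by
    refine mem_periods_of_iterate hF hΩ hs (n := 1) ?_
    rwa [pow_one, Function.iterate_one]
  refine hne n ?_
  rw [hPa 0 (by simp), hQb 0 (by simp), ← mem_periods_iff.1 hba' (0 + a)]
  exact congrArg P.1 (by abel)

omit [FiniteDimensional ℝ E] in
theorem LSub.subdivision_injective (s : LSub L Ω) (hs : Function.Injective s.substitution) :
    Function.Injective s.subdivision := by
  rintro ⟨_, P, hP, rfl⟩ ⟨_, Q, hQ, rfl⟩ h
  have h1 : (⟨P, hP⟩ : Ω) = ⟨Q, hQ⟩ := hs h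
  cases h1
  rfl

theorem LSub.exists_inverse_isLDMap (s : LSub L Ω) (hL : IsExpansive L) (hΩ : IsPatternSpace Ω)
    [CompactSpace Ω] [T2Space Ω] (hs : Function.Injective s.substitution) :
    ∃ T : Ω → inflateSpace L Ω, Function.LeftInverse T s.subdivision ∧
      Function.RightInverse T s.subdivision ∧ IsLDMap T := by
  obtain ⟨C, -, hF⟩ := s.exists_isLocalSequence hL
  obtain ⟨c, hc, h⟩ := s.exists_local_inverse hL hΩ hs
  choose g hg using s.substitution_surjective
  let T : Ω → inflateSpace L Ω := fun P => ⟨inflate L (g P).1, mem_image_of_mem _ (g P).2⟩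
  have hT : Function.RightInverse T s.subdivision := hg
  refine ⟨T, fun P => s.subdivision_injective hs (hT _), hT, c, hc, fun P Q x y hPQ => ?_⟩
  -- Equivariance under translation reduces the local rule at `x` to the local inverse at the
  -- origin.
  have hshift : ∀ (P : Ω) (x : E), s.substitution (spaceShift hΩ (L.symm x) (g P)) =
      spaceShift hΩ x P := by
    intro P x
    have := iterate_spaceShift hF hΩ 1 (L.symm x) (g P)
    rwa [pow_one, Function.iterate_one, LinearEquiv.apply_symm_apply, hg] at this
  have h1 := h (spaceShift hΩ (L.symm x) (g P)) (spaceShift hΩ (L.symm y) (g Q)) fun t ht => by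
    rw [hshift, hshift, spaceShift_apply, spaceShift_apply, add_comm t, add_comm t]
    exact patch_eq_iff.1 hPQ t (by simpa using ht)
  rw [spaceShift_apply, spaceShift_apply, zero_add, zero_add] at h1
  exact h1

end Recognizability

end PatternSpaces

theorem theorem4p7 {E : Type*} [NormedAddCommGroup E] [NormedSpace ℝ E] [FiniteDimensional ℝ E]
    {S : Type*} (Ω : Set (PatternSpaces.Pattern E S)) (hΩ : PatternSpaces.IsPatternSpace Ω)
    (L : E ≃ₗ[ℝ] E) (hL : PatternSpaces.IsExpansive L) (s : PatternSpaces.LSub L Ω) :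
    (PatternSpaces.IsFLC Ω ∧ PatternSpaces.IsWellSeparated Ω ↔ CompactSpace Ω ∧ T2Space Ω) ∧
    (PatternSpaces.IsFLC Ω → PatternSpaces.IsWellSeparated Ω →
      (Function.Injective s.substitution ↔
        ∀ P ∈ Ω, PatternSpaces.HasTrivialDiscreteComponent (PatternSpaces.periods P)) ∧
      (Function.Injective s.substitution → IsHomeomorph s.substitution) ∧
      (Function.Injective s.substitution →
        ∃ T : Ω → PatternSpaces.inflateSpace L Ω,
          Function.LeftInverse T s.subdivision ∧ Function.RightInverse T s.subdivision ∧
          PatternSpaces.IsLDMap T) ∧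
      ((∀ P ∈ Ω, DiscreteTopology (PatternSpaces.periods P)) ↔
        PatternSpaces.IsReturnDiscrete Ω) ∧
      ((∀ P ∈ Ω, DiscreteTopology (PatternSpaces.periods P)) →
        [Function.Injective s.substitution,
          ∀ P ∈ Ω, PatternSpaces.HasTrivialDiscreteComponent (PatternSpaces.periods P),
          PatternSpaces.IsAperiodic Ω].TFAE)) := by
  refine ⟨⟨fun h => ⟨h.1.compactSpace hΩ, h.2.t2Space hΩ⟩,
    fun ⟨_, _⟩ => ⟨hΩ.isFLC, hΩ.isWellSeparated⟩⟩, fun hflc hws => ?_⟩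
  have := hflc.compactSpace hΩ
  have := hws.t2Space hΩ
  have key : Function.Injective s.substitution ↔
      ∀ P ∈ Ω, PatternSpaces.HasTrivialDiscreteComponent (PatternSpaces.periods P) :=
    ⟨fun hs P hP => PatternSpaces.hasTrivialDiscreteComponent_of_le
        fun _ hz => s.mem_periodSpace_of_injective hL hΩ hs hP hz,
      fun h => s.injective_of_periods hL hΩ fun P hP _ hz => (h P hP).mem_periodSpace hΩ hP hz⟩
  refine ⟨key, fun hs => ?_, s.exists_inverse_isLDMap hL hΩ, ⟨fun h => ?_, fun h P hP =>
    h.discreteTopology hP⟩, fun h => ?_⟩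
  · exact isHomeomorph_iff_continuous_bijective.2
      ⟨s.continuous_substitution hL, hs, s.substitution_surjective⟩
  · refine hΩ.isReturnDiscrete fun P hP => ?_
    have := h P hP
    exact PatternSpaces.periodSpace_eq_bot P
  · tfae_have 1 ↔ 2 := key
    tfae_have 2 → 3 := by
      intro h2 P hP
      have := h P hP
      rw [PatternSpaces.Nonperiodic, AddSubgroup.eq_bot_iff_forall]
      intro z hz
      have hz' := (h2 P hP).mem_periodSpace hΩ hP hz
      rwa [PatternSpaces.periodSpace_eq_bot P, Submodule.mem_bot] at hz'
    tfae_have 3 → 2 := by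
      intro h3 P hP
      refine PatternSpaces.hasTrivialDiscreteComponent_of_le fun z hz => ?_
      have hbot : PatternSpaces.periods P = ⊥ := h3 P hP
      rw [hbot, AddSubgroup.mem_bot] at hz
      rw [hz]
      exact zero_mem _
    tfae_finish
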